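/- **Setting.** Let $\mathsf Z\subset\mathbb R^m$ be a Borel set, and let $\{z_t\}$, $\{\zeta_t\}$, $\{\eta_t\}$ be mutually independent iid sequences with values in $\mathsf Z$ and in two measurable spaces. Let $R_t=R(z_t,\zeta_t)$ and $Y_t=Y(z_t,\eta_t)$ with $R,Y\ge 0$ measurable; write $(\hat z,\hat R,\hat Y)$ for a generic copy of $(z_t,R_t,Y_t)$. Let $\beta\in[0,1)$ and let $u:\mathbb R_+\to\{-\infty\}\cup\mathbb R$ be increasing. A feasible policy is a Borel function $c:(0,\infty)\times\mathsf Z\to\mathbb R$ with $0\le c(a,z)\le a$, extended by $c(0,z)=0$. It generates, from $(a_0,z_0)=(a,z)$, the wealth path $a_{t+1}=R_{t+1}(a_t-c(a_t,z_t))+Y_{t+1}$ and has lifetime value $V_c(a,z)=\mathbb E_{a,z}\sum_{t\ge0}\beta^t u(c(a_t,z_t))$. It is optimal if $V_d\le V_c$ on $(0,\infty)\times\mathsf Z$ for every feasible policy $d$. Let $\mathscr C$ be the set of continuous $c:(0,\infty)\times\mathsf Z\to\mathbb R$ that are increasing in the first argument, with $0<c(a,z)\le a$ and $\sup_{(a,z)}|u'(c(a,z))-u'(a)|<\infty$.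 **Assumptions.** (With the conventions $u'(0)=\infty$ and $0\cdot\infty=0$.) 1. $u$ is real-valued and twice differentiable on $(0,\infty)$ with $u'>0$, $u''<0$, $u'(c)\to\infty$ as $c\to0$ and $u'(c)\to0$ as $c\to\infty$. 2. $\beta^n\,\mathbb E R_1\cdots R_n<1$ for some $n\in\mathbb N$. 3. $\sum_{t\ge1}\beta^t\,\mathbb E Y_t<\infty$. 4. $\mathbb E\hat R<\infty$, $\mathbb E u'(\hat Y)<\infty$ and $\mathbb E\hat R\,u'(\hat Y)<\infty$. 5. $z\mapsto R(z,\zeta)$ and $z\mapsto Y(z,\eta)$ are continuous for all $\zeta$ and $\eta$. 6. There is $\alpha\in(0,1)$ with $\beta\,\mathbb E\hat R\,u'[\hat R(1-\alpha)a]\le u'(a)$ for all $a>0$ and $(1-\alpha)^n\,\mathbb E R_1\cdots R_n<1$ for some $n\in\mathbb N$. 7. $\sup_{t\ge1}\mathbb E Y_t<\infty$. 8. For each $c\in\mathscr C$ that is concave in its first argument, $s\mapsto (u')^{-1}\big[\beta\,\mathbb E\hat R\,u'(c(\hat R s+\hat Y,\hat z))\big]$ is concave on $\mathbb R_+$ (this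 holds trivially if the bracket is identically $0$). **Theorem.** Under these assumptions there is exactly one optimal policy $c^*$ in $\mathscr C$, and it depends on wealth only. The stochastic kernel $Q$ on $\mathbb R_+$ of the Markov process $a_{t+1}=R_{t+1}[a_t-c^*(a_t)]+Y_{t+1}$ has exactly one stationary distribution $\psi^*$. Let $\mathscr L$ be the linear span of the increasing $\psi^*$-integrable functions $h:\mathbb R_+\to\mathbb R$. Then, for every probability measure $\mu$ on $\mathbb R_+$, when $a_0\sim\mu$ is independent of the shocks $\{(z_t,\zeta_t,\eta_t)\}_{t\ge1}$: 1. for every $h\in\mathscr L$, $$\mathbb P_\mu\Big\{\lim_{T\to\infty}\frac1T\sum_{t=1}^T h(a_t)=\int h\,d\psi^*\Big\}=1;$$ 2. $$\mathbb P_\mu\Big\{\lim_{T\to\infty}\frac1T\sum_{t=1}^T h(a_t)=\int h\,d\psi^*\ \text{ for all bounded continuous } h:\mathbb R_+\to\mathbb R\Big\}=1.$$ -/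

import Mathlib

open MeasureTheory ProbabilityTheory Filter Topology
open scoped NNReal ENNReal BoundedContinuousFunction

noncomputable section

/-- Primitives of the income fluctuation problem with capital income risk when the exogenous
state `z_t`, with values in a subset `Z` of Euclidean space, is iid. The innovations `ζ_t` and
`η_t` take values in measurable spaces `E` and `F`. Wealth, consumption, returns and labor income
are elements of `ℝ≥0 = [0, ∞)`. Utility takes values in `{-∞} ∪ ℝ`, see `UtilityAssumption`. -/
structure IncomeFluctuation {m : ℕ} (Z : Set (EuclideanSpace ℝ (Fin m))) (E F : Type*)
    [MeasurableSpace E] [MeasurableSpace F] where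
  /-- discount factor -/
  β : ℝ≥0
  β_lt_one : β < 1
  /-- utility function -/
  u : ℝ≥0 → EReal
  /-- gross rate of return as a function of `(z, ζ)` -/
  R : Z × E → ℝ≥0
  measurable_R : Measurable R
  /-- labor income as a function of `(z, η)` -/
  Y : Z × F → ℝ≥0
  measurable_Y : Measurable Y
  /-- common law of the `z_t` -/
  zLaw : Measure Z
  isProb_z : IsProbabilityMeasure zLaw
  /-- common law of the `ζ_t` -/
  ζLaw : Measure E
  isProb_ζ : IsProbabilityMeasure ζLaw
  /-- common law of the `η_t` -/
  ηLaw : Measure F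
  isProb_η : IsProbabilityMeasure ηLaw

namespace IncomeFluctuation

variable {m : ℕ} {Z : Set (EuclideanSpace ℝ (Fin m))} {E F : Type*}
  [MeasurableSpace E] [MeasurableSpace F] (M : IncomeFluctuation Z E F)

instance : IsProbabilityMeasure M.zLaw := M.isProb_z
instance : IsProbabilityMeasure M.ζLaw := M.isProb_ζ
instance : IsProbabilityMeasure M.ηLaw := M.isProb_η

/-- Return generated by a one-period shock `(z, ζ, η)`. -/
def ret (x : Z × E × F) : ℝ≥0 := M.R (x.1, x.2.1)

/-- Labor income generated by a one-period shock `(z, ζ, η)`. -/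
def inc (x : Z × E × F) : ℝ≥0 := M.Y (x.1, x.2.2)

lemma measurable_ret : Measurable M.ret :=
  M.measurable_R.comp (measurable_fst.prodMk (measurable_fst.comp measurable_snd))

lemma measurable_inc : Measurable M.inc :=
  M.measurable_Y.comp (measurable_fst.prodMk (measurable_snd.comp measurable_snd))

/-- Law of the one-period shock `(z_t, ζ_t, η_t)`. -/
def shockLaw : Measure (Z × E × F) := M.zLaw.prod (M.ζLaw.prod M.ηLaw)

instance : IsProbabilityMeasure M.shockLaw := by unfold shockLaw; infer_instance

/-- Law of the iid sequence of shocks. Coordinate `t` is the shock of period `t + 1`. -/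
def seqLaw : Measure (ℕ → Z × E × F) := Measure.infinitePi (fun _ => M.shockLaw)

/-- The utility function as a real function of a real variable; used on `(0, ∞)` only. -/
def uReal (x : ℝ) : ℝ := (M.u x.toNNReal).toReal

/-- Marginal utility `u'`, with `u'(0) = ∞`. -/
def marg (c : ℝ≥0) : ℝ≥0∞ := if c = 0 then ⊤ else ENNReal.ofReal (deriv M.uReal c)

/-- `u : [0, ∞) → {-∞} ∪ ℝ` is increasing, real-valued and twice differentiable on `(0, ∞)` with
`u' > 0` and `u'' < 0`, and satisfies the Inada conditions. -/
structure UtilityAssumption : Prop where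
  ne_top : ∀ c, M.u c ≠ ⊤
  ne_bot : ∀ c, 0 < c → M.u c ≠ ⊥
  u_zero_le : ∀ c, M.u 0 ≤ M.u c
  differentiable : DifferentiableOn ℝ M.uReal (Set.Ioi 0)
  differentiable_deriv : DifferentiableOn ℝ (deriv M.uReal) (Set.Ioi 0)
  deriv_pos : ∀ c : ℝ, 0 < c → 0 < deriv M.uReal c
  deriv_deriv_neg : ∀ c : ℝ, 0 < c → deriv (deriv M.uReal) c < 0
  tendsto_zero : Tendsto (deriv M.uReal) (𝓝[>] 0) atTop
  tendsto_top : Tendsto (deriv M.uReal) atTop (𝓝 0)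

/-- The state path `(a_t, z_t)` generated by a policy `c` from the initial state `s`, along a
realization `w` of the shocks. -/
def statePath (c : ℝ≥0 × Z → ℝ≥0) (s : ℝ≥0 × Z) (w : ℕ → Z × E × F) : ℕ → ℝ≥0 × Z
  | 0 => s
  | t + 1 => (M.ret (w t) * ((statePath c s w t).1 - c (statePath c s w t)) + M.inc (w t), (w t).1)

/-- A feasible policy: a Borel function with `0 ≤ c(a,z) ≤ a`. A policy on `(0, ∞) × Z` is extended
to `[0, ∞) × Z` by `c(0,z) = 0`, which the second condition forces. -/
structure Feasible (c : ℝ≥0 × Z → ℝ≥0) : Prop where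
  measurable : Measurable c
  le : ∀ a z, c (a, z) ≤ a

/-- Lifetime value `E_{a,z} ∑_t β^t u(c(a_t, z_t))` in `[-∞, ∞]`: the expected discounted sum
of the positive parts minus that of the negative parts. -/
def lifetimeValue (c : ℝ≥0 × Z → ℝ≥0) (s : ℝ≥0 × Z) : EReal :=
  ((∫⁻ w, ∑' t, (M.β : ℝ≥0∞) ^ t * (M.u (c (M.statePath c s w t))).toENNReal ∂M.seqLaw : ℝ≥0∞) :
      EReal) -
    ((∫⁻ w, ∑' t, (M.β : ℝ≥0∞) ^ t * (-M.u (c (M.statePath c s w t))).toENNReal ∂M.seqLaw :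
      ℝ≥0∞) : EReal)

/-- An optimal policy: feasible, and at least as good as every feasible policy at every state
with positive wealth. -/
def IsOptimal (c : ℝ≥0 × Z → ℝ≥0) : Prop :=
  Feasible c ∧ ∀ d, Feasible d → ∀ a z, 0 < a →
    M.lifetimeValue d (a, z) ≤ M.lifetimeValue c (a, z)

/-- The class `𝒞` of candidate policies on `(0, ∞) × Z` (extended by `c(0,z) = 0`). -/
structure Candidate (c : ℝ≥0 × Z → ℝ≥0) : Prop where
  continuousOn : ContinuousOn c {s | 0 < s.1}
  mono : ∀ z, Monotone fun a => c (a, z)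
  pos : ∀ a z, 0 < a → 0 < c (a, z)
  le : ∀ a z, c (a, z) ≤ a
  bounded : ∃ K : ℝ, ∀ a z, 0 < a → |deriv M.uReal (c (a, z)) - deriv M.uReal a| ≤ K

/-- The standing assumptions. Since `z_t` is iid, expectations conditional on `z_0 = z`
do not depend on `z`. Products in `ℝ≥0∞` obey `0 * ∞ = 0`. -/
structure Assumptions : Prop where
  utility : M.UtilityAssumption
  /-- `β^n E R_1 ⋯ R_n < 1` for some `n` -/
  contraction : ∃ n : ℕ,
    (M.β : ℝ≥0∞) ^ n * ∫⁻ w, ∏ i ∈ Finset.range n, (M.ret (w i) : ℝ≥0∞) ∂M.seqLaw < 1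
  /-- `∑_{t ≥ 1} β^t E Y_t < ∞` -/
  income_sum : (∑' t : ℕ, (M.β : ℝ≥0∞) ^ (t + 1) * ∫⁻ w, (M.inc (w t) : ℝ≥0∞) ∂M.seqLaw) < ⊤
  ret_finite : ∫⁻ x, (M.ret x : ℝ≥0∞) ∂M.shockLaw < ⊤
  marg_finite : ∫⁻ x, M.marg (M.inc x) ∂M.shockLaw < ⊤
  ret_marg_finite : ∫⁻ x, (M.ret x : ℝ≥0∞) * M.marg (M.inc x) ∂M.shockLaw < ⊤
  continuous_R : ∀ ζ, Continuous fun z => M.R (z, ζ)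
  continuous_Y : ∀ η, Continuous fun z => M.Y (z, η)
  /-- some `α ∈ (0,1)` has `β E R u'(R (1-α) a) ≤ u'(a)` for all `a > 0`, and
  `(1-α)^n E R_1 ⋯ R_n < 1` for some `n` -/
  consumption_rate : ∃ α : ℝ≥0, 0 < α ∧ α < 1 ∧
    (∀ a : ℝ≥0, 0 < a →
      (M.β : ℝ≥0∞) * ∫⁻ x, (M.ret x : ℝ≥0∞) * M.marg (M.ret x * (1 - α) * a) ∂M.shockLaw
        ≤ M.marg a) ∧
    ∃ n : ℕ, ((1 - α : ℝ≥0) : ℝ≥0∞) ^ n *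
      ∫⁻ w, ∏ i ∈ Finset.range n, (M.ret (w i) : ℝ≥0∞) ∂M.seqLaw < 1
  /-- `sup_{t ≥ 1} E Y_t < ∞` -/
  income_bounded : (⨆ t : ℕ, ∫⁻ w, (M.inc (w t) : ℝ≥0∞) ∂M.seqLaw) < ⊤
  /-- `s ↦ (u')⁻¹(β E R u'(c(R s + Y, z)))` is concave on `[0, ∞)` for every candidate policy `c`
  that is concave in wealth. The argument of `(u')⁻¹` is `0` for all `s` or for no `s`, and in
  the former case the map is a constant. -/
  concave : ∀ c : ℝ≥0 × Z → ℝ≥0, M.Candidate c →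
    (∀ z, ConcaveOn ℝ≥0 (Set.Ioi 0) fun a => c (a, z)) →
    ConcaveOn ℝ≥0 Set.univ fun s : ℝ≥0 => Function.invFun M.marg
      ((M.β : ℝ≥0∞) *
        ∫⁻ x, (M.ret x : ℝ≥0∞) * M.marg (c (M.ret x * s + M.inc x, x.1)) ∂M.shockLaw)

/-- Next period's wealth under a policy `c` that depends on wealth only. -/
def nextAsset (c : ℝ≥0 → ℝ≥0) (a : ℝ≥0) (x : Z × E × F) : ℝ≥0 :=
  M.ret x * (a - c a) + M.inc x

lemma measurable_nextAsset {c : ℝ≥0 → ℝ≥0} (hc : Measurable c) :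
    Measurable fun p : ℝ≥0 × (Z × E × F) => M.nextAsset c p.1 p.2 :=
  ((M.measurable_ret.comp measurable_snd).mul
    (measurable_fst.sub (hc.comp measurable_fst))).add (M.measurable_inc.comp measurable_snd)

/-- The stochastic kernel `Q` of the wealth process: `Q(a, ·)` is the law of `R (a - c(a)) + Y`. -/
def assetKernel {c : ℝ≥0 → ℝ≥0} (hc : Measurable c) : Kernel ℝ≥0 ℝ≥0 where
  toFun a := M.shockLaw.map (M.nextAsset c a)
  measurable' := by
    refine Measure.measurable_of_measurable_coe _ fun B hB => ?_
    have h (a : ℝ≥0) : M.shockLaw.map (M.nextAsset c a) B =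
        M.shockLaw (Prod.mk a ⁻¹' ((fun p : ℝ≥0 × (Z × E × F) => M.nextAsset c p.1 p.2) ⁻¹' B)) :=
      Measure.map_apply ((M.measurable_nextAsset hc).comp measurable_prodMk_left) hB
    simp_rw [h]
    exact measurable_measure_prodMk_left (M.measurable_nextAsset hc hB)

/-- `a` is the wealth process under policy `c` with initial distribution `μ₀`, defined on a
probability space `(Ω, P)` and driven by iid shocks; `x t` is the shock `(z, ζ, η)` of
period `t + 1`. -/
structure IsWealthPath (c : ℝ≥0 → ℝ≥0) (μ₀ : Measure ℝ≥0) {Ω : Type*} [MeasurableSpace Ω]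
    (P : Measure Ω) (x : ℕ → Ω → Z × E × F) (a : ℕ → Ω → ℝ≥0) : Prop where
  measurable_shock : ∀ t, Measurable (x t)
  measurable_init : Measurable (a 0)
  law_shock : ∀ t, P.map (x t) = M.shockLaw
  law_init : P.map (a 0) = μ₀
  indep_shock : iIndepFun x P
  indep_init : IndepFun (a 0) (fun ω t => x t ω) P
  step : ∀ t ω, a (t + 1) ω = M.nextAsset c (a t ω) (x t ω)

end IncomeFluctuation

/-- The linear span of the increasing `ψ`-integrable functions `ℝ₊ → ℝ`. -/
def increasingSpan (ψ : Measure ℝ≥0) : Submodule ℝ (ℝ≥0 → ℝ) :=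
  Submodule.span ℝ {h | Monotone h ∧ Integrable h ψ}

end


/-!
A marginal value function `g` determines consumption at wealth `a` as the solution `ξ ≤ a` of
`u'(ξ) = max(u'(a), g(a - ξ))`, and the least fixed point of the resulting monotone operator on
functions `g` yields a policy that solves the Euler equation. The consumption rate assumption makes
this policy consume a fixed share `α` of wealth with `(1 - α) E R < 1`. Concavity of `u` and the
Euler equation bound the value of any other feasible policy by that of the Euler policy, strictly
where the two policies differ.

Under the Euler policy next period's wealth is increasing in wealth, and mean wealth stays bounded.
As long as savings are positive, the Euler equation gives `u'(c(a_t)) = β E_t R u'(c(a_{t+1}))`;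
since `β E R < 1` and `u' ∘ c` is positive, savings reach zero with probability bounded away from
zero on bounded sets of wealth, hence almost surely. At that date the paths from all smaller initial
wealth levels have zero savings too and merge, so any two paths driven by the same shocks
coalesce. Coalescence makes the skew product of the wealth dynamics over the shift on shocks
ergodic, which gives uniqueness of the stationary law and, by Birkhoff's theorem, the law of large
numbers from every initial law. A stationary law exists as the law of the limit of the backward
iterates started at zero wealth, which are increasing and bounded in mean.
-/
/-! ### Sequences of iid shocks -/

section IIDSequence

variable {S : Type*}

/-- The sequence `x, w 0, w 1, …`. -/
def seqCons (x : S) (w : ℕ → S) : ℕ → S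
  | 0 => x
  | n + 1 => w n

/-- The one-sided shift `w 1, w 2, …`. -/
def seqShift (w : ℕ → S) : ℕ → S := fun n => w (n + 1)

@[simp] lemma seqCons_zero (x : S) (w : ℕ → S) : seqCons x w 0 = x := rfl

@[simp] lemma seqCons_succ (x : S) (w : ℕ → S) (n : ℕ) : seqCons x w (n + 1) = w n := rfl

@[simp] lemma seqShift_seqCons (x : S) (w : ℕ → S) : seqShift (seqCons x w) = w := rfl

lemma seqCons_seqShift (w : ℕ → S) : seqCons (w 0) (seqShift w) = w := by
  ext (_ | n) <;> rfl

lemma iterate_seqShift_apply (k : ℕ) (w : ℕ → S) (i : ℕ) : seqShift^[k] w i = w (i + k) := by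
  induction k generalizing w with
  | zero => rfl
  | succ k ih => rw [Function.iterate_succ_apply, ih]; rfl

variable [MeasurableSpace S]

lemma measurable_seqCons : Measurable fun p : S × (ℕ → S) => seqCons p.1 p.2 := by
  refine measurable_pi_lambda _ fun n => ?_
  cases n with
  | zero => exact measurable_fst
  | succ n => exact (measurable_pi_apply n).comp measurable_snd

lemma measurable_seqShift : Measurable (seqShift : (ℕ → S) → ℕ → S) :=
  measurable_pi_lambda _ fun n => measurable_pi_apply (n + 1)

lemma comap_iterate_seqShift_le (k : ℕ) :
    MeasurableSpace.comap (seqShift^[k] : (ℕ → S) → ℕ → S) inferInstance ≤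
      ⨆ i ≥ k, MeasurableSpace.comap (fun w : ℕ → S => w i) inferInstance := by
  refine measurable_iff_comap_le.1 (@measurable_pi_lambda _ _ _ (_) _ _ fun i => ?_)
  simp only [iterate_seqShift_apply]
  exact (comap_measurable fun w : ℕ → S => w (i + k)).mono
    (le_iSup₂_of_le (i + k) (Nat.le_add_left k i) le_rfl) le_rfl

variable (ν : Measure S) [IsProbabilityMeasure ν]

lemma iIndep_comap_eval_infinitePi :
    iIndep (fun n => MeasurableSpace.comap (fun w : ℕ → S => w n) inferInstance)
      (Measure.infinitePi fun _ => ν) :=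
  iIndepFun_infinitePi (P := fun _ : ℕ => ν) (X := fun _ x => x) fun _ => measurable_id

lemma measurePreserving_seqShift :
    MeasurePreserving (seqShift : (ℕ → S) → ℕ → S)
      (Measure.infinitePi fun _ => ν) (Measure.infinitePi fun _ => ν) :=
  ⟨measurable_seqShift, Measure.map_infinitePi_infinitePi_of_inj (add_left_injective 1)⟩

lemma indepFun_eval_zero_seqShift :
    IndepFun (fun w : ℕ → S => w 0) seqShift (Measure.infinitePi fun _ => ν) := by
  have hind := indep_iSup_of_disjoint (fun n => (measurable_pi_apply n).comap_le)
    (iIndep_comap_eval_infinitePi ν) (S := {0}) (T := Set.Ici 1) (by simp)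
  rw [IndepFun_iff_Indep]
  refine indep_of_indep_of_le_left (indep_of_indep_of_le_right hind ?_) (by simp)
  simpa using comap_iterate_seqShift_le (S := S) 1

lemma measurePreserving_seqCons :
    MeasurePreserving (fun p : S × (ℕ → S) => seqCons p.1 p.2)
      (ν.prod (Measure.infinitePi fun _ => ν)) (Measure.infinitePi fun _ => ν) := by
  refine ⟨measurable_seqCons, ?_⟩
  have hsplit := (indepFun_iff_map_prod_eq_prod_map_map (measurable_pi_apply 0).aemeasurable
    measurable_seqShift.aemeasurable).1 (indepFun_eval_zero_seqShift ν)
  rw [(measurePreserving_eval_infinitePi (fun _ => ν) 0).map_eq,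
    (measurePreserving_seqShift ν).map_eq] at hsplit
  rw [← hsplit, Measure.map_map measurable_seqCons
    ((measurable_pi_apply 0).prodMk measurable_seqShift)]
  simp only [Function.comp_def, seqCons_seqShift, Measure.map_id']

lemma lintegral_infinitePi_eq_seqCons {f : (ℕ → S) → ℝ≥0∞} (hf : Measurable f) :
    ∫⁻ w, f w ∂Measure.infinitePi (fun _ => ν) =
      ∫⁻ x, ∫⁻ w, f (seqCons x w) ∂Measure.infinitePi (fun _ => ν) ∂ν := by
  rw [← (measurePreserving_seqCons ν).lintegral_comp hf,
    lintegral_prod (fun p : S × (ℕ → S) => f (seqCons p.1 p.2))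
      (hf.comp measurable_seqCons).aemeasurable]

lemma measure_infinitePi_eq_seqCons {B : Set (ℕ → S)} (hB : MeasurableSet B) :
    Measure.infinitePi (fun _ => ν) B =
      ∫⁻ x, Measure.infinitePi (fun _ => ν) (seqCons x ⁻¹' B) ∂ν := by
  rw [← (measurePreserving_seqCons ν).measure_preimage hB.nullMeasurableSet,
    Measure.prod_apply (measurable_seqCons hB)]
  rfl

lemma lintegral_infinitePi_prod_range {f : S → ℝ≥0∞} (hf : Measurable f) (n : ℕ) :
    ∫⁻ w, ∏ i ∈ Finset.range n, f (w i) ∂Measure.infinitePi (fun _ : ℕ => ν) =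
      (∫⁻ x, f x ∂ν) ^ n := by
  induction n with
  | zero => simp
  | succ n ih =>
    have hprod (k : ℕ) : Measurable fun w : ℕ → S => ∏ i ∈ Finset.range k, f (w i) :=
      Finset.measurable_fun_prod _ fun i _ => hf.comp (measurable_pi_apply i)
    rw [lintegral_infinitePi_eq_seqCons ν (hprod _)]
    simp_rw [Finset.prod_range_succ', seqCons_zero, seqCons_succ,
      lintegral_mul_const _ (hprod n), ih]
    rw [lintegral_const_mul _ hf, pow_succ]

lemma ae_infinitePi_iff_ae_seqCons {p : (ℕ → S) → Prop} (hp : MeasurableSet {w | p w}) :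
    (∀ᵐ w ∂Measure.infinitePi (fun _ => ν), p w) ↔
      ∀ᵐ x ∂ν, ∀ᵐ w ∂Measure.infinitePi (fun _ => ν), p (seqCons x w) := by
  rw [← (measurePreserving_seqCons ν).map_eq, ae_map_iff measurable_seqCons.aemeasurable hp,
    (measurePreserving_seqCons ν).map_eq]
  exact Measure.ae_prod_iff_ae_ae (measurable_seqCons hp)

/-- A shift-invariant event is a tail event, so Kolmogorov's zero-one law applies. -/
theorem ergodic_seqShift :
    Ergodic (seqShift : (ℕ → S) → ℕ → S) (Measure.infinitePi fun _ => ν) where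
  toMeasurePreserving := measurePreserving_seqShift ν
  aeconst_set D hD hinv := by
    have hiter (k : ℕ) : seqShift^[k] ⁻¹' D = D := by
      rw [Set.preimage_iterate_eq]
      exact Function.iterate_fixed hinv k
    have htail : MeasurableSet[limsup
        (fun n => MeasurableSpace.comap (fun w : ℕ → S => w n) inferInstance) atTop] D := by
      rw [limsup_eq_iInf_iSup_of_nat, MeasurableSpace.measurableSet_iInf]
      exact fun k => comap_iterate_seqShift_le k _ ⟨D, hD, hiter k⟩
    rw [eventuallyConst_set']
    rcases measure_zero_or_one_of_measurableSet_limsup_atTop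
      (fun n => (measurable_pi_apply n).comap_le) (iIndep_comap_eval_infinitePi ν) htail
      with h0 | h1
    · exact .inl (ae_eq_empty.2 h0)
    · exact .inr (ae_eq_univ.2 ((prob_compl_eq_zero_iff hD).2 h1))

end IIDSequence

/-! ### The pointwise ergodic theorem -/

section PointwiseErgodic

variable {X : Type*}

/-- The largest of the Birkhoff sums `S_0 g = 0, S_1 g, …, S_n g`, computed by the recursion
`S_{k+1} g = g + S_k g ∘ T`. -/
def birkhoffMax (T : X → X) (g : X → ℝ) : ℕ → X → ℝ
  | 0 => fun _ => 0
  | n + 1 => fun x => max 0 (g x + birkhoffMax T g n (T x))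

lemma birkhoffMax_nonneg (T : X → X) (g : X → ℝ) (n : ℕ) (x : X) : 0 ≤ birkhoffMax T g n x := by
  cases n with
  | zero => exact le_rfl
  | succ n => exact le_max_left _ _

lemma monotone_birkhoffMax (T : X → X) (g : X → ℝ) (x : X) :
    Monotone fun n => birkhoffMax T g n x := by
  refine monotone_nat_of_le_succ fun n => ?_
  induction n generalizing x with
  | zero => exact birkhoffMax_nonneg T g 1 x
  | succ n ih => exact max_le_max le_rfl (by gcongr; exact ih _)

lemma birkhoffSum_le_birkhoffMax (T : X → X) (g : X → ℝ) (n : ℕ) (x : X) :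
    birkhoffSum T g n x ≤ birkhoffMax T g n x := by
  induction n generalizing x with
  | zero => simp [birkhoffMax]
  | succ n ih =>
    rw [birkhoffSum_succ']
    exact le_max_of_le_right (by gcongr; exact ih _)

lemma birkhoffMax_succ_sub (T : X → X) (g : X → ℝ) (n : ℕ) (x : X) :
    birkhoffMax T g (n + 1) x - birkhoffMax T g n (T x) =
      max (-birkhoffMax T g n (T x)) (g x) := by
  rw [birkhoffMax, ← max_sub_sub_right, zero_sub, add_sub_cancel_right]

lemma eventually_neg_le_birkhoffMax_of_not_bddAbove {T : X → X} {g : X → ℝ} {x : X}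
    (hx : ¬ BddAbove (Set.range fun n => birkhoffSum T g n x)) :
    ∀ᶠ n in atTop, -g x ≤ birkhoffMax T g n (T x) := by
  suffices ∃ N, -g x ≤ birkhoffMax T g N (T x) by
    obtain ⟨N, hN⟩ := this
    filter_upwards [eventually_ge_atTop N] with n hn
    exact hN.trans (monotone_birkhoffMax T g (T x) hn)
  by_contra! hlt
  refine hx ⟨0, Set.forall_mem_range.2 fun n => ?_⟩
  cases n with
  | zero => simp
  | succ n =>
    rw [birkhoffSum_succ']
    linarith [birkhoffSum_le_birkhoffMax T g n (T x), hlt n]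

lemma preimage_setOf_bddAbove_birkhoffSum (T : X → X) (g : X → ℝ) :
    T ⁻¹' {x | BddAbove (Set.range fun n => birkhoffSum T g n x)} =
      {x | BddAbove (Set.range fun n => birkhoffSum T g n x)} := by
  ext x
  refine ⟨fun ⟨B, hB⟩ => ⟨max 0 (g x + B), ?_⟩, fun ⟨B, hB⟩ => ⟨B - g x, ?_⟩⟩
  · rintro _ ⟨_ | n, rfl⟩
    · simp
    · simp only [birkhoffSum_succ']
      exact le_max_of_le_right (by gcongr; exact hB ⟨n, rfl⟩)
  · rintro _ ⟨n, rfl⟩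
    have hsucc := hB ⟨n + 1, rfl⟩
    simp only [birkhoffSum_succ'] at hsucc
    linarith

lemma eventually_div_lt_of_bddAbove_sub_mul {s : ℕ → ℝ} {b c : ℝ} (hbc : b < c)
    (hs : BddAbove (Set.range fun n => s n - n * b)) : ∀ᶠ n : ℕ in atTop, s n / n < c := by
  obtain ⟨B, hB⟩ := hs
  filter_upwards [eventually_gt_atTop 0, eventually_gt_atTop ⌈B / (c - b)⌉₊] with n hn hlarge
  have hsn : s n - n * b ≤ B := hB ⟨n, rfl⟩
  have hBn : B < n * (c - b) := (div_lt_iff₀ (sub_pos.2 hbc)).1 (Nat.lt_of_ceil_lt hlarge)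
  rw [div_lt_iff₀ (Nat.cast_pos.2 hn)]
  linarith

variable [MeasurableSpace X] {P : Measure X} {T : X → X} {f g : X → ℝ}

lemma integrable_birkhoffMax (hT : MeasurePreserving T P P) (hg : Integrable g P) (n : ℕ) :
    Integrable (birkhoffMax T g n) P := by
  induction n with
  | zero => exact integrable_zero _ _ _
  | succ n ih =>
    exact (integrable_zero _ _ _).sup (hg.add (hT.integrable_comp_of_integrable ih))

lemma integral_max_neg_birkhoffMax_nonneg (hT : MeasurePreserving T P P) (hg : Integrable g P)
    (n : ℕ) : 0 ≤ ∫ x, max (-birkhoffMax T g n (T x)) (g x) ∂P := by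
  have hint (n : ℕ) := integrable_birkhoffMax hT hg n
  have hinvariant : ∫ x, birkhoffMax T g n (T x) ∂P = ∫ x, birkhoffMax T g n x ∂P := by
    conv_rhs => rw [← hT.map_eq]
    rw [integral_map hT.aemeasurable (hT.map_eq.symm ▸ (hint n).aestronglyMeasurable)]
  simp_rw [← birkhoffMax_succ_sub]
  rw [integral_sub (hint _) (by exact hT.integrable_comp_of_integrable (hint n)), hinvariant,
    sub_nonneg]
  exact integral_mono (hint _) (hint _) fun x => monotone_birkhoffMax T g x n.le_succ

/-- A form of the maximal ergodic theorem: `max (-M_n ∘ T) g`, where `M_n` is the maximal Birkhoff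
sum, has nonnegative integral and tends to `g` wherever the Birkhoff sums are unbounded. -/
lemma integral_nonneg_of_ae_not_bddAbove_birkhoffSum (hT : MeasurePreserving T P P)
    (hg : Integrable g P)
    (h : ∀ᵐ x ∂P, ¬ BddAbove (Set.range fun n => birkhoffSum T g n x)) :
    0 ≤ ∫ x, g x ∂P := by
  have hintT (n : ℕ) : Integrable (fun x => birkhoffMax T g n (T x)) P :=
    hT.integrable_comp_of_integrable (integrable_birkhoffMax hT hg n)
  refine ge_of_tendsto' (tendsto_integral_of_dominated_convergence (fun x => ‖g x‖)
    (fun n => ((hintT n).neg.sup hg).aestronglyMeasurable) hg.norm (fun n => ?_) ?_)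
    (integral_max_neg_birkhoffMax_nonneg hT hg)
  · refine .of_forall fun x => abs_le.2 ⟨le_max_of_le_right (neg_abs_le _), ?_⟩
    exact max_le ((neg_nonpos.2 (birkhoffMax_nonneg T g n (T x))).trans (abs_nonneg _))
      (le_abs_self _)
  · filter_upwards [h] with x hx
    refine tendsto_const_nhds.congr' ?_
    filter_upwards [eventually_neg_le_birkhoffMax_of_not_bddAbove hx] with n hn
    exact (max_eq_right (neg_le.1 hn)).symm

lemma nullMeasurableSet_bddAbove_birkhoffSum (hT : MeasurePreserving T P P)
    (hg : AEMeasurable g P) :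
    NullMeasurableSet {x | BddAbove (Set.range fun n => birkhoffSum T g n x)} P := by
  have hsum (n : ℕ) : AEMeasurable (birkhoffSum T g n) P :=
    Finset.aemeasurable_fun_sum _ fun k _ =>
      hg.comp_quasiMeasurePreserving (hT.iterate k).quasiMeasurePreserving
  have hset : {x | BddAbove (Set.range fun n => birkhoffSum T g n x)} =
      ⋃ B : ℕ, ⋂ n, {x | birkhoffSum T g n x ≤ B} := by
    ext x
    simp only [Set.mem_ofPred_eq, Set.mem_iUnion, Set.mem_iInter]
    refine ⟨fun ⟨B, hB⟩ => ?_, fun ⟨B, hB⟩ => ⟨B, Set.forall_mem_range.2 hB⟩⟩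
    obtain ⟨N, hN⟩ := exists_nat_ge B
    exact ⟨N, fun n => (hB ⟨n, rfl⟩).trans hN⟩
  rw [hset]
  exact .iUnion fun B => .iInter fun n => nullMeasurableSet_le (hsum n) aemeasurable_const

/-- Boundedness above of the Birkhoff sums is an invariant event, and the maximal ergodic theorem
excludes that it is null when `∫ g < 0`. -/
lemma ae_bddAbove_birkhoffSum_of_integral_neg (hT : Ergodic T P) (hg : Integrable g P)
    (hneg : ∫ x, g x ∂P < 0) :
    ∀ᵐ x ∂P, BddAbove (Set.range fun n => birkhoffSum T g n x) := by
  refine (hT.quasiErgodic.ae_mem_or_ae_notMem₀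
    (nullMeasurableSet_bddAbove_birkhoffSum hT.toMeasurePreserving hg.aemeasurable)
    (.of_eq (preimage_setOf_bddAbove_birkhoffSum T g))).resolve_right fun hunbdd => ?_
  exact hneg.not_ge
    (integral_nonneg_of_ae_not_bddAbove_birkhoffSum hT.toMeasurePreserving hg hunbdd)

variable [IsProbabilityMeasure P]

lemma ae_eventually_birkhoffAverage_lt (hT : Ergodic T P) (hf : Integrable f P) {c : ℝ}
    (hc : ∫ x, f x ∂P < c) : ∀ᵐ x ∂P, ∀ᶠ n in atTop, birkhoffAverage ℝ T f n x < c := by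
  obtain ⟨b, hfb, hbc⟩ := exists_between hc
  have hneg : ∫ x, (f x - b) ∂P < 0 := by
    rw [integral_sub hf (integrable_const b)]
    simpa using hfb
  filter_upwards [ae_bddAbove_birkhoffSum_of_integral_neg hT (hf.sub (integrable_const b)) hneg]
    with x hx
  have hsum (n : ℕ) : birkhoffSum T (f - fun _ => b) n x = birkhoffSum T f n x - n * b := by
    simp [birkhoffSum]
  simp only [hsum] at hx
  simpa only [birkhoffAverage, smul_eq_mul, inv_mul_eq_div] using
    eventually_div_lt_of_bddAbove_sub_mul hbc hx

theorem ae_tendsto_birkhoffAverage_of_ergodic (hT : Ergodic T P) (hf : Integrable f P) :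
    ∀ᵐ x ∂P, Tendsto (fun n => birkhoffAverage ℝ T f n x) atTop (𝓝 (∫ x, f x ∂P)) := by
  have hupper : ∀ᵐ x ∂P, ∀ q : ℚ, ∫ x, f x ∂P < q →
      ∀ᶠ n in atTop, birkhoffAverage ℝ T f n x < q :=
    ae_all_iff.2 fun q => ae_all_iff.2 fun hq => ae_eventually_birkhoffAverage_lt hT hf hq
  have hlower : ∀ᵐ x ∂P, ∀ q : ℚ, q < ∫ x, f x ∂P →
      ∀ᶠ n in atTop, q < birkhoffAverage ℝ T f n x := by
    refine ae_all_iff.2 fun q => ae_all_iff.2 fun hq => ?_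
    have hneg : ∫ x, -f x ∂P < -q := by rw [integral_neg]; exact neg_lt_neg hq
    filter_upwards [ae_eventually_birkhoffAverage_lt hT hf.neg hneg] with x hx
    filter_upwards [hx] with n hn
    rw [birkhoffAverage_neg] at hn
    exact neg_lt_neg_iff.1 hn
  filter_upwards [hupper, hlower] with x hxu hxl
  refine tendsto_order.2 ⟨fun c hc => ?_, fun c hc => ?_⟩
  · obtain ⟨q, hcq, hq⟩ := exists_rat_btwn hc
    exact (hxl q hq).mono fun n hn => hcq.trans hn
  · obtain ⟨q, hq, hqc⟩ := exists_rat_btwn hc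
    exact (hxu q hq).mono fun n hn => hn.trans hqc

end PointwiseErgodic

/-! ### Time averages -/

section TimeAverage

/-- The average of a sequence over the times `1, …, T`; its value at `T = 0` is `0`. -/
noncomputable def timeAverage (x : ℕ → ℝ) (T : ℕ) : ℝ := (1 / (T : ℝ)) * ∑ t ∈ Finset.Icc 1 T, x t

lemma timeAverage_eq_inv_mul_sum_range (x : ℕ → ℝ) (T : ℕ) :
    timeAverage x T = (T : ℝ)⁻¹ * ∑ t ∈ Finset.range T, x (t + 1) := by
  rw [timeAverage, one_div, Finset.range_eq_Ico, Finset.sum_Ico_add']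
  rfl

lemma timeAverage_iterate_eq_birkhoffAverage {X : Type*} (T : X → X) (h : X → ℝ) (x : X) (n : ℕ) :
    timeAverage (fun t => h (T^[t] x)) n = birkhoffAverage ℝ T h n (T x) := by
  simp only [timeAverage_eq_inv_mul_sum_range, birkhoffAverage, birkhoffSum, smul_eq_mul,
    Function.iterate_succ_apply]

lemma tendsto_timeAverage_of_eventuallyEq {x y : ℕ → ℝ} {l : ℝ} (hxy : x =ᶠ[atTop] y)
    (hx : Tendsto (timeAverage x) atTop (𝓝 l)) : Tendsto (timeAverage y) atTop (𝓝 l) := by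
  have hdiff : Tendsto (fun t => y (t + 1) - x (t + 1)) atTop (𝓝 0) := by
    refine tendsto_const_nhds.congr' ?_
    filter_upwards [(tendsto_add_atTop_nat 1).eventually hxy] with t ht
    rw [ht, sub_self]
  have hsum := hdiff.cesaro.add hx
  rw [zero_add] at hsum
  refine hsum.congr fun T => ?_
  simp only [timeAverage_eq_inv_mul_sum_range, Finset.sum_sub_distrib]
  ring

variable {X : Type*} [MeasurableSpace X]

/-- The empirical distribution of `y 1, …, y (n + 1)`. -/
noncomputable def empiricalMeasure (y : ℕ → X) (n : ℕ) : Measure X :=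
  ((n + 1 : ℕ) : ℝ≥0∞)⁻¹ • ∑ t ∈ Finset.range (n + 1), Measure.dirac (y (t + 1))

instance (y : ℕ → X) (n : ℕ) : IsProbabilityMeasure (empiricalMeasure y n) where
  measure_univ := by
    simp only [empiricalMeasure, Measure.smul_apply, Measure.finsetSum_apply, measure_univ,
      Finset.sum_const, Finset.card_range, nsmul_eq_mul, mul_one, smul_eq_mul]
    exact ENNReal.inv_mul_cancel (by simp) (ENNReal.natCast_ne_top _)

lemma integral_empiricalMeasure (y : ℕ → X) (n : ℕ) {h : X → ℝ} (hh : Measurable h) :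
    ∫ x, h x ∂empiricalMeasure y n = timeAverage (fun t => h (y t)) (n + 1) := by
  rw [empiricalMeasure, integral_smul_measure, integral_finsetSum_measure fun t _ =>
    integrable_dirac' hh.stronglyMeasurable (by simp), timeAverage_eq_inv_mul_sum_range]
  simp only [integral_dirac' _ _ hh.stronglyMeasurable, ENNReal.toReal_inv,
    ENNReal.toReal_natCast, smul_eq_mul]

lemma empiricalMeasure_real (y : ℕ → X) (n : ℕ) {U : Set X} (hU : MeasurableSet U) :
    (empiricalMeasure y n).real U = timeAverage (fun t => U.indicator 1 (y t)) (n + 1) := by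
  rw [← integral_empiricalMeasure y n (measurable_one.indicator hU), integral_indicator_one hU]

lemma exists_countable_isPiSystem_isTopologicalBasis (X : Type*) [TopologicalSpace X]
    [SecondCountableTopology X] :
    ∃ 𝒮 : Set (Set X), 𝒮.Countable ∧ IsPiSystem 𝒮 ∧ TopologicalSpace.IsTopologicalBasis 𝒮 := by
  have hbasis := TopologicalSpace.isBasis_countableBasis X
  refine ⟨_, (Set.countable_ofPred_finite_subset
    (TopologicalSpace.countable_countableBasis X)).image Set.sInter, ?_,
    TopologicalSpace.isTopologicalBasis_of_subbasis hbasis.eq_generateFrom⟩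
  rintro _ ⟨s, ⟨hs, hsb⟩, rfl⟩ _ ⟨t, ⟨ht, htb⟩, rfl⟩ -
  exact ⟨s ∪ t, ⟨hs.union ht, Set.union_subset hsb htb⟩, Set.sInter_union s t⟩

theorem tendsto_timeAverage_of_isPiSystem_isTopologicalBasis [TopologicalSpace X]
    [SecondCountableTopology X] [OpensMeasurableSpace X] {ψ : Measure X} [IsProbabilityMeasure ψ]
    {𝒮 : Set (Set X)} (hpi : IsPiSystem 𝒮) (hbasis : TopologicalSpace.IsTopologicalBasis 𝒮)
    {y : ℕ → X} (hfreq : ∀ U ∈ 𝒮,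
      Tendsto (timeAverage fun t => U.indicator 1 (y t)) atTop (𝓝 (ψ.real U)))
    (h : X →ᵇ ℝ) : Tendsto (timeAverage fun t => h (y t)) atTop (𝓝 (∫ x, h x ∂ψ)) := by
  have hmeas : ∀ U ∈ 𝒮, MeasurableSet U := fun U hU => (hbasis.isOpen hU).measurableSet
  let law (n : ℕ) : ProbabilityMeasure X := ⟨empiricalMeasure y n, inferInstance⟩
  have hweak : Tendsto law atTop (𝓝 ⟨ψ, inferInstance⟩) := by
    refine hpi.tendsto_probabilityMeasure_of_tendsto_of_mem hmeas (fun G hG x hx => ?_)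
      fun U hU => ?_
    · obtain ⟨U, hU, hxU, hUG⟩ := hbasis.exists_subset_of_mem_open hx hG
      exact ⟨U, hU, (hbasis.isOpen hU).mem_nhds hxU, hUG⟩
    · rw [← NNReal.tendsto_coe]
      refine ((tendsto_add_atTop_iff_nat 1).2 (hfreq U hU)).congr fun n => ?_
      exact (empiricalMeasure_real y n (hmeas U hU)).symm
  refine (tendsto_add_atTop_iff_nat 1).1 ?_
  refine (ProbabilityMeasure.tendsto_iff_forall_integral_tendsto.1 hweak h).congr fun n => ?_
  exact integral_empiricalMeasure y n h.continuous.measurable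

theorem ae_forall_boundedContinuous_tendsto_timeAverage [TopologicalSpace X]
    [SecondCountableTopology X] [OpensMeasurableSpace X] {ψ : Measure X} [IsProbabilityMeasure ψ]
    {Ω : Type*} [MeasurableSpace Ω] {P : Measure Ω} {y : ℕ → Ω → X}
    (hfreq : ∀ U, MeasurableSet U → ∀ᵐ ω ∂P,
      Tendsto (timeAverage fun t => U.indicator 1 (y t ω)) atTop (𝓝 (ψ.real U))) :
    ∀ᵐ ω ∂P, ∀ h : X →ᵇ ℝ,
      Tendsto (timeAverage fun t => h (y t ω)) atTop (𝓝 (∫ x, h x ∂ψ)) := by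
  obtain ⟨𝒮, hcount, hpi, hbasis⟩ := exists_countable_isPiSystem_isTopologicalBasis X
  have hall : ∀ᵐ ω ∂P, ∀ U ∈ 𝒮,
      Tendsto (timeAverage fun t => U.indicator 1 (y t ω)) atTop (𝓝 (ψ.real U)) :=
    (ae_ball_iff hcount).2 fun U hU => hfreq U (hbasis.isOpen hU).measurableSet
  filter_upwards [hall] with ω hω
  exact tendsto_timeAverage_of_isPiSystem_isTopologicalBasis hpi hbasis hω

end TimeAverage

/-! ### Iterated random functions -/

section RandomIteration

variable {X S : Type*}

/-- The path of `a_{t+1} = f(a_t, w_t)` started at `a`. -/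
def iterPath (f : X → S → X) (a : X) (w : ℕ → S) : ℕ → X
  | 0 => a
  | t + 1 => f (iterPath f a w t) (w t)

lemma iterPath_succ' (f : X → S → X) (a : X) (w : ℕ → S) (t : ℕ) :
    iterPath f a w (t + 1) = iterPath f (f a (w 0)) (seqShift w) t := by
  induction t with
  | zero => rfl
  | succ t ih => rw [iterPath, ih]; rfl

/-- The deterministic dynamics `(a, w) ↦ (f(a, w_0), (w_1, w_2, …))` that drives the state `a` by
the shock sequence `w`. -/
def skewProd (f : X → S → X) (p : X × (ℕ → S)) : X × (ℕ → S) := (f p.1 (p.2 0), seqShift p.2)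

lemma iterate_skewProd (f : X → S → X) (t : ℕ) (p : X × (ℕ → S)) :
    (skewProd f)^[t] p = (iterPath f p.1 p.2 t, seqShift^[t] p.2) := by
  induction t generalizing p with
  | zero => rfl
  | succ t ih => rw [Function.iterate_succ_apply, ih, iterPath_succ']; rfl

variable [MeasurableSpace S] {f : X → S → X} {ν : Measure S} [IsProbabilityMeasure ν]

/-- Almost surely, any two paths driven by the same iid shocks of law `ν` eventually coincide. -/
def Coalescing (f : X → S → X) (ν : Measure S) [IsProbabilityMeasure ν] : Prop :=
  ∀ a b, ∀ᵐ w ∂Measure.infinitePi (fun _ : ℕ => ν),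
    ∀ᶠ t in atTop, iterPath f a w t = iterPath f b w t

lemma Coalescing.ae_mem_iff_mem_of_preimage_skewProd_eq (hc : Coalescing f ν)
    {D : Set (X × (ℕ → S))} (hinv : skewProd f ⁻¹' D = D) (a b : X) :
    ∀ᵐ w ∂Measure.infinitePi (fun _ : ℕ => ν), (a, w) ∈ D ↔ (b, w) ∈ D := by
  have hiter (t : ℕ) (p : X × (ℕ → S)) : (skewProd f)^[t] p ∈ D ↔ p ∈ D := by
    rw [← Set.mem_preimage, Set.preimage_iterate_eq, Function.iterate_fixed hinv]
  filter_upwards [hc a b] with w hw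
  obtain ⟨t, ht⟩ := hw.exists
  rw [← hiter t (a, w), ← hiter t (b, w), iterate_skewProd, iterate_skewProd, ht]

variable [MeasurableSpace X]

lemma measurable_iterPath (hf : Measurable fun p : X × S => f p.1 p.2) (t : ℕ) :
    Measurable fun p : X × (ℕ → S) => iterPath f p.1 p.2 t := by
  induction t with
  | zero => exact measurable_fst
  | succ t ih => exact hf.comp (ih.prodMk ((measurable_pi_apply t).comp measurable_snd))

lemma measurable_iterPath_right (hf : Measurable fun p : X × S => f p.1 p.2) (a : X) (t : ℕ) :
    Measurable fun w : ℕ → S => iterPath f a w t :=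
  (measurable_iterPath hf t).comp measurable_prodMk_left

lemma measurePreserving_skewProd (hf : Measurable fun p : X × S => f p.1 p.2)
    {ψ : Measure X} [IsProbabilityMeasure ψ] (hψ : (ψ.prod ν).map (fun p => f p.1 p.2) = ψ) :
    MeasurePreserving (skewProd f) (ψ.prod (Measure.infinitePi fun _ => ν))
      (ψ.prod (Measure.infinitePi fun _ => ν)) := by
  set P := Measure.infinitePi fun _ : ℕ => ν
  have hskew : Measurable (skewProd f) :=
    (hf.comp (measurable_fst.prodMk ((measurable_pi_apply 0).comp measurable_snd))).prodMk
      (measurable_seqShift.comp measurable_snd)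
  have hassemble : MeasurePreserving (fun q : (X × S) × (ℕ → S) => (q.1.1, seqCons q.1.2 q.2))
      ((ψ.prod ν).prod P) (ψ.prod P) :=
    ((MeasurePreserving.id ψ).prod (measurePreserving_seqCons ν)).comp
      (measurePreserving_prodAssoc ψ ν P)
  have hstep : MeasurePreserving (Prod.map (fun p : X × S => f p.1 p.2) (id : (ℕ → S) → ℕ → S))
      ((ψ.prod ν).prod P) (ψ.prod P) :=
    MeasurePreserving.prod ⟨hf, hψ⟩ (MeasurePreserving.id P)
  refine ⟨hskew, ?_⟩
  conv_lhs => rw [← hassemble.map_eq]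
  rw [Measure.map_map hskew hassemble.measurable]
  exact hstep.map_eq

namespace Coalescing

/-- Coalescence makes the sections of an invariant event equal, hence shift-invariant. -/
theorem ergodic_skewProd (hc : Coalescing f ν) (hf : Measurable fun p : X × S => f p.1 p.2)
    {ψ : Measure X} [IsProbabilityMeasure ψ] (hψ : (ψ.prod ν).map (fun p => f p.1 p.2) = ψ) :
    Ergodic (skewProd f) (ψ.prod (Measure.infinitePi fun _ => ν)) where
  toMeasurePreserving := measurePreserving_skewProd hf hψ
  aeconst_set D hD hinv := by
    obtain ⟨b⟩ := nonempty_of_isProbabilityMeasure ψ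
    have hsection := hc.ae_mem_iff_mem_of_preimage_skewProd_eq hinv
    have hDb : MeasurableSet (Prod.mk b ⁻¹' D : Set (ℕ → S)) := measurable_prodMk_left hD
    have hshift : seqShift ⁻¹' (Prod.mk b ⁻¹' D) =ᵐ[Measure.infinitePi fun _ => ν]
        Prod.mk b ⁻¹' D := by
      refine eventuallyEq_set.2 ((ae_infinitePi_iff_ae_seqCons ν
        ((measurable_seqShift hDb).iff hDb)).2 (.of_forall fun x => ?_))
      filter_upwards [hsection b (f b x)] with w hw
      have hstep : (b, seqCons x w) ∈ D ↔ (f b x, w) ∈ D := by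
        conv_lhs => rw [← hinv]
        rfl
      exact hw.trans hstep.symm
    rw [eventuallyConst_set]
    rcases (ergodic_seqShift ν).quasiErgodic.ae_mem_or_ae_notMem₀ hDb.nullMeasurableSet hshift
      with hmem | hnotMem
    · refine .inl ((Measure.ae_prod_iff_ae_ae hD).2 (.of_forall fun a => ?_))
      filter_upwards [hsection a b, hmem] with w hw hb using hw.2 hb
    · refine .inr ((Measure.ae_prod_iff_ae_ae hD.compl).2 (.of_forall fun a => ?_))
      filter_upwards [hsection a b, hnotMem] with w hw hb using mt hw.1 hb

/-- By ergodicity the averages converge from almost every initial condition, and by coalescence the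
limit does not depend on the initial condition. -/
theorem ae_tendsto_timeAverage_iterPath (hc : Coalescing f ν)
    (hf : Measurable fun p : X × S => f p.1 p.2) {ψ : Measure X} [IsProbabilityMeasure ψ]
    (hψ : (ψ.prod ν).map (fun p => f p.1 p.2) = ψ) {h : X → ℝ} (hint : Integrable h ψ) (a : X) :
    ∀ᵐ w ∂Measure.infinitePi (fun _ : ℕ => ν),
      Tendsto (timeAverage fun t => h (iterPath f a w t)) atTop (𝓝 (∫ y, h y ∂ψ)) := by
  set P := Measure.infinitePi fun _ : ℕ => ν
  have hergodic : Ergodic (skewProd f) (ψ.prod P) := hc.ergodic_skewProd hf hψ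
  have hstationary : ∀ᵐ p ∂ψ.prod P,
      Tendsto (timeAverage fun t => h (iterPath f p.1 p.2 t)) atTop (𝓝 (∫ y, h y ∂ψ)) := by
    filter_upwards [hergodic.quasiMeasurePreserving.ae
      (ae_tendsto_birkhoffAverage_of_ergodic hergodic (hint.comp_fst P))] with p hp
    rw [integral_fun_fst h, probReal_univ, one_smul] at hp
    simpa only [← timeAverage_iterate_eq_birkhoffAverage, iterate_skewProd] using hp
  obtain ⟨b, hb⟩ := (Measure.ae_ae_of_ae_prod hstationary).exists
  filter_upwards [hb, hc b a] with w hconv hcoalesce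
  exact tendsto_timeAverage_of_eventuallyEq (hcoalesce.mono fun t ht => congrArg h ht) hconv

theorem stationary_unique (hc : Coalescing f ν) (hf : Measurable fun p : X × S => f p.1 p.2)
    {ψ φ : Measure X} [IsProbabilityMeasure ψ] [IsProbabilityMeasure φ]
    (hψ : (ψ.prod ν).map (fun p => f p.1 p.2) = ψ)
    (hφ : (φ.prod ν).map (fun p => f p.1 p.2) = φ) : φ = ψ := by
  obtain ⟨a⟩ := nonempty_of_isProbabilityMeasure ψ
  refine Measure.ext fun A hA => ?_
  have hindicator (ρ : Measure X) [IsProbabilityMeasure ρ] :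
      Integrable (A.indicator (1 : X → ℝ)) ρ := (integrable_const 1).indicator hA
  obtain ⟨w, hw, hw'⟩ := ((hc.ae_tendsto_timeAverage_iterPath hf hψ (hindicator ψ) a).and
    (hc.ae_tendsto_timeAverage_iterPath hf hφ (hindicator φ) a)).exists
  have hreal := tendsto_nhds_unique hw' hw
  rw [integral_indicator_one hA, integral_indicator_one hA] at hreal
  exact (measureReal_eq_measureReal_iff).1 hreal

lemma ae_prod_eventually_iterPath_eq [MeasurableEq X] (hc : Coalescing f ν)
    (hf : Measurable fun p : X × S => f p.1 p.2) (μ : Measure X) (b : X) :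
    ∀ᵐ p ∂μ.prod (Measure.infinitePi fun _ => ν),
      ∀ᶠ t in atTop, iterPath f p.1 p.2 t = iterPath f b p.2 t := by
  have hmeas : MeasurableSet {p : X × (ℕ → S) |
      ∀ᶠ t in atTop, iterPath f p.1 p.2 t = iterPath f b p.2 t} := by
    simp only [eventually_atTop, Set.ofPred_exists, Set.ofPred_forall]
    exact .iUnion fun N => .iInter fun t => .iInter fun _ => measurableSet_eq_fun
      (measurable_iterPath hf t) ((measurable_iterPath_right hf b t).comp measurable_snd)
  exact (Measure.ae_prod_iff_ae_ae hmeas).2 (.of_forall fun a => hc a b)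

theorem ae_tendsto_timeAverage_of_map_eq_prod [MeasurableEq X] (hc : Coalescing f ν)
    (hf : Measurable fun p : X × S => f p.1 p.2) {ψ : Measure X} [IsProbabilityMeasure ψ]
    (hψ : (ψ.prod ν).map (fun p => f p.1 p.2) = ψ) {Ω : Type*} [MeasurableSpace Ω]
    {P : Measure Ω} {μ : Measure X} [IsProbabilityMeasure μ] {a₀ : Ω → X} {x : Ω → ℕ → S}
    (hmp : MeasurePreserving (fun ω => (a₀ ω, x ω)) P (μ.prod (Measure.infinitePi fun _ => ν)))
    {h : X → ℝ} (hint : Integrable h ψ) :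
    ∀ᵐ ω ∂P, Tendsto (timeAverage fun t => h (iterPath f (a₀ ω) (x ω) t)) atTop
      (𝓝 (∫ y, h y ∂ψ)) := by
  obtain ⟨b⟩ := nonempty_of_isProbabilityMeasure ψ
  have hx : MeasurePreserving x P (Measure.infinitePi fun _ => ν) := measurePreserving_snd.comp hmp
  filter_upwards [hx.quasiMeasurePreserving.ae (hc.ae_tendsto_timeAverage_iterPath hf hψ hint b),
    hmp.quasiMeasurePreserving.ae (hc.ae_prod_eventually_iterPath_eq hf μ b)]
    with ω hconv hcoalesce
  exact tendsto_timeAverage_of_eventuallyEq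
    (hcoalesce.mono fun t ht => congrArg h ht.symm) hconv

end Coalescing

end RandomIteration

/-! ### The savings rule induced by a marginal value of savings -/

section SavingsRule

/-- The savings levels out of wealth `a` at which the marginal utility of consumption, given by the
function `v`, does not exceed the marginal value `g` of savings. -/
def savingsSet (v g : ℝ≥0 → ℝ≥0∞) (a : ℝ≥0) : Set ℝ≥0 := {s | s ≤ a ∧ v (a - s) ≤ g s}

/-- Optimal savings out of wealth `a`, for marginal utility `v` and marginal value `g` of
savings. If no level of savings is worth its cost, then `sSup ∅ = 0` is the right choice. -/
noncomputable def savings (v g : ℝ≥0 → ℝ≥0∞) (a : ℝ≥0) : ℝ≥0 := sSup (savingsSet v g a)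

/-- Consumption out of wealth `a` that goes with the rule `savings`. -/
noncomputable def consumption (v g : ℝ≥0 → ℝ≥0∞) (a : ℝ≥0) : ℝ≥0 := a - savings v g a

variable {v g g' : ℝ≥0 → ℝ≥0∞} {a s : ℝ≥0}

lemma bddAbove_savingsSet (v g : ℝ≥0 → ℝ≥0∞) (a : ℝ≥0) : BddAbove (savingsSet v g a) :=
  ⟨a, fun _ hs => hs.1⟩

lemma savings_le (v g : ℝ≥0 → ℝ≥0∞) (a : ℝ≥0) : savings v g a ≤ a := csSup_le' fun _ hs => hs.1

lemma sub_consumption (v g : ℝ≥0 → ℝ≥0∞) (a : ℝ≥0) : a - consumption v g a = savings v g a :=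
  tsub_tsub_cancel_of_le (savings_le v g a)

lemma savings_le_savings (hgg' : g ≤ g') (a : ℝ≥0) : savings v g a ≤ savings v g' a :=
  csSup_le_csSup' (bddAbove_savingsSet v g' a) fun s hs => ⟨hs.1, hs.2.trans (hgg' s)⟩

lemma consumption_le_consumption (hgg' : g ≤ g') (a : ℝ≥0) :
    consumption v g' a ≤ consumption v g a :=
  tsub_le_tsub_left (savings_le_savings hgg' a) a

lemma monotone_savings (hv : Antitone v) (g : ℝ≥0 → ℝ≥0∞) : Monotone (savings v g) :=
  fun _ b hab => csSup_le_csSup' (bddAbove_savingsSet v g b) fun s hs =>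
    ⟨hs.1.trans hab, (hv (tsub_le_tsub_right hab s)).trans hs.2⟩

lemma savings_add_le (hg : Antitone g) (a h : ℝ≥0) :
    savings v g (a + h) ≤ savings v g a + h := by
  refine csSup_le' fun s hs => ?_
  rcases le_total s h with hsh | hsh
  · exact hsh.trans le_add_self
  · obtain ⟨r, rfl⟩ := exists_add_of_le hsh
    rw [add_comm h r] at hs ⊢
    have hr : r ∈ savingsSet v g a := by
      refine ⟨le_of_add_le_add_right hs.1, ?_⟩
      have hmarginal := hs.2
      rw [add_tsub_add_eq_tsub_right] at hmarginal
      exact hmarginal.trans (hg le_self_add)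
    gcongr
    exact le_csSup (bddAbove_savingsSet v g a) hr

lemma monotone_consumption (hg : Antitone g) : Monotone (consumption v g) := by
  intro a b hab
  obtain ⟨h, rfl⟩ := exists_add_of_le hab
  refine le_tsub_of_add_le_right ?_
  calc a - savings v g a + savings v g (a + h) ≤ a - savings v g a + (savings v g a + h) := by
        gcongr
        exact savings_add_le hg a h
    _ = a + h := by rw [← add_assoc, tsub_add_cancel_of_le (savings_le v g a)]

lemma continuous_savings (hv : Antitone v) (hg : Antitone g) : Continuous (savings v g) := by
  have hlip : LipschitzWith 1 fun a : ℝ≥0 => (savings v g a : ℝ) := by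
    refine LipschitzWith.of_le_add fun a b => ?_
    rcases le_total a b with hab | hab
    · exact (NNReal.coe_le_coe.2 (monotone_savings hv g hab)).trans
        (le_add_of_nonneg_right dist_nonneg)
    · obtain ⟨h, rfl⟩ := exists_add_of_le hab
      have hdist : dist (b + h) b = h := by simp [NNReal.dist_eq]
      rw [hdist]
      exact_mod_cast savings_add_le hg b h
  exact NNReal.isEmbedding_coe.continuous_iff.2 hlip.continuous

lemma continuous_consumption (hv : Antitone v) (hg : Antitone g) : Continuous (consumption v g) :=
  continuous_id.sub (continuous_savings hv hg)

lemma mem_savingsSet_of_lt (hv : Antitone v) (hg : Antitone g) (hs : s < savings v g a) :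
    s ∈ savingsSet v g a := by
  obtain ⟨r, hr, hsr⟩ := exists_lt_of_lt_csSup' hs
  exact ⟨hsr.le.trans hr.1, (hv (tsub_le_tsub_left hsr.le a)).trans (hr.2.trans (hg hsr.le))⟩

lemma apply_consumption_le_of_savings_pos (hv : Antitone v) (hvc : Continuous v) (hg : Antitone g)
    (hg'c : Continuous g') (hgg' : g ≤ g') (hpos : 0 < savings v g a) :
    v (consumption v g a) ≤ g' (savings v g a) := by
  have hclosed : IsClosed {s | v (a - s) ≤ g' s} :=
    isClosed_le (hvc.comp (continuous_const.sub continuous_id)) hg'c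
  have hbelow : Set.Iio (savings v g a) ⊆ {s | v (a - s) ≤ g' s} := fun s hs =>
    (mem_savingsSet_of_lt hv hg hs).2.trans (hgg' s)
  refine hclosed.closure_subset_iff.2 hbelow ?_
  rw [closure_Iio' (show (Set.Iio (savings v g a)).Nonempty from ⟨0, hpos⟩)]
  exact Set.self_mem_Iic

lemma apply_consumption_le_max (hv : Antitone v) (hvc : Continuous v) (hg : Antitone g) (a : ℝ≥0) :
    v (consumption v g a) ≤ max (v a) (g 0) := by
  rcases eq_zero_or_pos (savings v g a) with hzero | hpos
  · simp [consumption, hzero]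
  · exact le_max_of_le_right (apply_consumption_le_of_savings_pos (g' := fun _ => g 0) hv hvc hg
      continuous_const (fun _ => hg zero_le) hpos)

lemma le_apply_consumption (hvc : Continuous v) (hv0 : v 0 = ⊤) (hgc : Continuous g) (a : ℝ≥0) :
    g (savings v g a) ≤ v (consumption v g a) := by
  rcases (savings_le v g a).eq_or_lt with heq | hlt
  · simp [consumption, heq, hv0]
  · have hclosed : IsClosed {s | g s ≤ v (a - s)} :=
      isClosed_le hgc (hvc.comp (continuous_const.sub continuous_id))
    have habove : Set.Ioo (savings v g a) a ⊆ {s | g s ≤ v (a - s)} := by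
      intro s hs
      by_contra hvg
      exact notMem_of_csSup_lt hs.1 (bddAbove_savingsSet v g a) ⟨hs.2.le, (not_le.1 hvg).le⟩
    refine hclosed.closure_subset_iff.2 habove ?_
    rw [closure_Ioo hlt.ne]
    exact ⟨le_rfl, hlt.le⟩

lemma mul_le_consumption {α : ℝ≥0} (hα : α < 1) (hv : StrictAnti v) (a : ℝ≥0) :
    α * a ≤ consumption v (fun s => v (α / (1 - α) * s)) a := by
  have hα' : 0 < 1 - α := tsub_pos_of_lt hα
  have hsum : α + (1 - α) = 1 := add_tsub_cancel_of_le hα.le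
  have hsavings : savings v (fun s => v (α / (1 - α) * s)) a ≤ (1 - α) * a := by
    refine csSup_le' fun s hs => ?_
    have hle : α / (1 - α) * s + s ≤ a := (le_tsub_iff_right hs.1).1 (hv.le_iff_ge.1 hs.2)
    calc s = (1 - α) * (α / (1 - α) * s + s) := by field_simp; rw [hsum, mul_one]
      _ ≤ (1 - α) * a := by gcongr
  refine le_tsub_of_add_le_right ?_
  calc α * a + savings v _ a ≤ α * a + (1 - α) * a := by gcongr
    _ = a := by rw [← add_mul, hsum, one_mul]

end SavingsRule


/-! ### Discounted sums along random iterations -/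

lemma ennreal_add_mul_div_one_sub {ρ : ℝ≥0∞} (hρ : ρ < 1) (L : ℝ≥0∞) :
    L + ρ * (L / (1 - ρ)) = L / (1 - ρ) := by
  have hL : (1 - ρ) * (L / (1 - ρ)) = L :=
    ENNReal.mul_div_cancel (tsub_pos_of_lt hρ).ne' (ENNReal.sub_ne_top ENNReal.one_ne_top)
  calc L + ρ * (L / (1 - ρ)) = (1 - ρ) * (L / (1 - ρ)) + ρ * (L / (1 - ρ)) := by rw [hL]
    _ = L / (1 - ρ) := by rw [← add_mul, tsub_add_cancel_of_le hρ.le, one_mul]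

section Discounted

variable {X X' S : Type*} [MeasurableSpace S] {f : X → S → X} {f' : X' → S → X'}
  {ν : Measure S} [IsProbabilityMeasure ν] {β : ℝ≥0∞} {φ φ' : X → ℝ≥0∞}

/-- The discounted expectation `β ^ t * E φ(a_t)` along the random path from `a_0 = s`. -/
noncomputable def discountedMean (f : X → S → X) (ν : Measure S) [IsProbabilityMeasure ν]
    (β : ℝ≥0∞) (φ : X → ℝ≥0∞) (t : ℕ) (s : X) : ℝ≥0∞ :=
  ∫⁻ w, β ^ t * φ (iterPath f s w t) ∂Measure.infinitePi (fun _ : ℕ => ν)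

/-- The expected discounted sum `∑ t, β ^ t * E φ(a_t)` along the random path from `a_0 = s`. -/
noncomputable def discountedSum (f : X → S → X) (ν : Measure S) [IsProbabilityMeasure ν]
    (β : ℝ≥0∞) (φ : X → ℝ≥0∞) (s : X) : ℝ≥0∞ :=
  ∑' t, discountedMean f ν β φ t s

lemma discountedMean_zero (s : X) : discountedMean f ν β φ 0 s = φ s := by
  simp [discountedMean, iterPath]

lemma discountedSum_comp {π : X → X'} (hπ : ∀ s x, π (f s x) = f' (π s) x) (φ : X' → ℝ≥0∞)
    (s : X) : discountedSum f ν β (fun s => φ (π s)) s = discountedSum f' ν β φ (π s) := by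
  have hpath (w : ℕ → S) (t : ℕ) : π (iterPath f s w t) = iterPath f' (π s) w t := by
    induction t with
    | zero => rfl
    | succ t ih => rw [iterPath, hπ, ih, iterPath]
  simp only [discountedSum, discountedMean, hpath]

lemma tendsto_sum_discountedMean (s : X) :
    Tendsto (fun T => ∑ t ∈ Finset.range T, discountedMean f ν β φ t s) atTop
      (𝓝 (discountedSum f ν β φ s)) :=
  ENNReal.summable.hasSum.tendsto_sum_nat

variable [MeasurableSpace X]

lemma discountedMean_succ (hf : Measurable fun p : X × S => f p.1 p.2) (hφ : Measurable φ)
    (t : ℕ) (s : X) :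
    discountedMean f ν β φ (t + 1) s = β * ∫⁻ x, discountedMean f ν β φ t (f s x) ∂ν := by
  have hpath (t : ℕ) (a : X) : Measurable fun w : ℕ → S => φ (iterPath f a w t) :=
    hφ.comp ((measurable_iterPath hf t).comp measurable_prodMk_left)
  have hmean : Measurable fun x =>
      ∫⁻ w, φ (iterPath f (f s x) w t) ∂Measure.infinitePi fun _ => ν :=
    (Measurable.lintegral_prod_right' (f := fun p : X × (ℕ → S) => φ (iterPath f p.1 p.2 t))
      (hφ.comp (measurable_iterPath hf t))).comp (hf.comp measurable_prodMk_left)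
  calc discountedMean f ν β φ (t + 1) s
      = β ^ (t + 1) * ∫⁻ x, ∫⁻ w, φ (iterPath f (f s x) w t)
          ∂Measure.infinitePi (fun _ => ν) ∂ν := by
        rw [discountedMean, lintegral_const_mul _ (hpath (t + 1) s),
          lintegral_infinitePi_eq_seqCons ν (hpath (t + 1) s)]
        simp only [iterPath_succ', seqCons_zero, seqShift_seqCons]
    _ = β * ∫⁻ x, discountedMean f ν β φ t (f s x) ∂ν := by
        simp only [discountedMean, lintegral_const_mul _ (hpath t _)]
        rw [lintegral_const_mul _ hmean, pow_succ',
          mul_assoc]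

lemma measurable_discountedMean (hf : Measurable fun p : X × S => f p.1 p.2) (hφ : Measurable φ)
    (t : ℕ) : Measurable (discountedMean f ν β φ t) :=
  Measurable.lintegral_prod_right'
    (f := fun p : X × (ℕ → S) => β ^ t * φ (iterPath f p.1 p.2 t))
    ((hφ.comp (measurable_iterPath hf t)).const_mul _)

lemma sum_discountedMean_succ (hf : Measurable fun p : X × S => f p.1 p.2) (hφ : Measurable φ)
    (T : ℕ) (s : X) : ∑ t ∈ Finset.range (T + 1), discountedMean f ν β φ t s =
      φ s + β * ∫⁻ x, ∑ t ∈ Finset.range T, discountedMean f ν β φ t (f s x) ∂ν := by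
  have hmeas (t : ℕ) : Measurable fun x => discountedMean f ν β φ t (f s x) :=
    (measurable_discountedMean hf hφ t).comp (hf.comp measurable_prodMk_left)
  rw [Finset.sum_range_succ', discountedMean_zero, add_comm,
    lintegral_finsetSum _ fun t _ => hmeas t, Finset.mul_sum]
  simp_rw [discountedMean_succ hf hφ]

lemma lintegral_tsum_eq_discountedSum (hf : Measurable fun p : X × S => f p.1 p.2)
    (hφ : Measurable φ) (s : X) :
    ∫⁻ w, ∑' t, β ^ t * φ (iterPath f s w t) ∂Measure.infinitePi (fun _ : ℕ => ν) =
      discountedSum f ν β φ s :=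
  lintegral_tsum fun t => ((hφ.comp ((measurable_iterPath hf t).comp
    measurable_prodMk_left)).const_mul _).aemeasurable

lemma discountedSum_add (hf : Measurable fun p : X × S => f p.1 p.2) (hφ : Measurable φ)
    (φ' : X → ℝ≥0∞) (s : X) : discountedSum f ν β (fun s => φ s + φ' s) s =
      discountedSum f ν β φ s + discountedSum f ν β φ' s := by
  have hmeas (t : ℕ) : Measurable fun w : ℕ → S => β ^ t * φ (iterPath f s w t) :=
    (hφ.comp ((measurable_iterPath hf t).comp measurable_prodMk_left)).const_mul _
  simp only [discountedSum, discountedMean, mul_add, lintegral_add_left (hmeas _)]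
  exact ENNReal.tsum_add

lemma discountedSum_le_of_supersolution (hf : Measurable fun p : X × S => f p.1 p.2)
    (hφ : Measurable φ) {Φ : X → ℝ≥0∞} (hΦ : ∀ s, φ s + β * ∫⁻ x, Φ (f s x) ∂ν ≤ Φ s) (s : X) :
    discountedSum f ν β φ s ≤ Φ s := by
  refine ENNReal.tsum_le_of_sum_range_le fun T => ?_
  induction T generalizing s with
  | zero => simp
  | succ T ih =>
    rw [sum_discountedMean_succ hf hφ]
    refine le_trans ?_ (hΦ s)
    gcongr with x
    exact ih _

lemma discountedSum_ne_top_of_le (hf : Measurable fun p : X × S => f p.1 p.2)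
    (hφ' : Measurable φ') {C : ℝ≥0∞} (hC : C ≠ ⊤) (hle : ∀ s, φ s ≤ C * φ' s) {s : X}
    (hfin : discountedSum f ν β φ' s ≠ ⊤) : discountedSum f ν β φ s ≠ ⊤ := by
  refine ne_top_of_le_ne_top (ENNReal.mul_ne_top hC hfin) ?_
  rw [discountedSum, discountedSum, ← ENNReal.tsum_mul_left]
  refine ENNReal.tsum_le_tsum fun t => ?_
  have hmeas : Measurable fun w : ℕ → S => β ^ t * φ' (iterPath f s w t) :=
    ((hφ'.comp (measurable_iterPath hf t)).comp measurable_prodMk_left).const_mul _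
  rw [discountedMean, discountedMean, ← lintegral_const_mul C hmeas]
  refine lintegral_mono fun w => ?_
  rw [mul_left_comm]
  gcongr
  exact hle _

variable {A B U V : X → ℝ≥0∞} {p : X} {δ : ℝ≥0∞}

lemma sum_discountedMean_add_le_succ (hf : Measurable fun p : X × S => f p.1 p.2)
    (hA : Measurable A) (hB : Measurable B) (hV : Measurable V)
    (hUfin : β * ∫⁻ x, U (f p x) ∂ν ≠ ⊤) (hVfin : β * ∫⁻ x, V (f p x) ∂ν ≠ ⊤)
    (hp : A p + V p + δ + β * ∫⁻ x, U (f p x) ∂ν ≤ B p + U p + β * ∫⁻ x, V (f p x) ∂ν) {T : ℕ}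
    (hT : ∀ᵐ x ∂ν, ∑ t ∈ Finset.range T, discountedMean f ν β A t (f p x) + V (f p x) ≤
      ∑ t ∈ Finset.range T, discountedMean f ν β B t (f p x) + U (f p x) +
        discountedMean f ν β V T (f p x)) :
    ∑ t ∈ Finset.range (T + 1), discountedMean f ν β A t p + V p + δ ≤
      ∑ t ∈ Finset.range (T + 1), discountedMean f ν β B t p + U p +
        discountedMean f ν β V (T + 1) p := by
  have hfp : Measurable (f p) := hf.comp measurable_prodMk_left
  have hsum {φ : X → ℝ≥0∞} (hφ : Measurable φ) :
      Measurable fun x => ∑ t ∈ Finset.range T, discountedMean f ν β φ t (f p x) :=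
    Finset.measurable_fun_sum _ fun t _ => (measurable_discountedMean hf hφ t).comp hfp
  have hVmean : Measurable fun x => discountedMean f ν β V T (f p x) :=
    (measurable_discountedMean hf hV T).comp hfp
  have hmean := mul_le_mul_right (lintegral_mono_ae hT) β
  rw [lintegral_add_left (hsum hA), lintegral_add_right _ hVmean,
    lintegral_add_left (hsum hB), mul_add, mul_add, mul_add, ← discountedMean_succ hf hV] at hmean
  rw [sum_discountedMean_succ hf hA, sum_discountedMean_succ hf hB]
  refine (ENNReal.add_le_add_iff_right (ENNReal.add_ne_top.2 ⟨hUfin, hVfin⟩)).1 ?_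
  refine le_trans (le_of_eq ?_) ((add_le_add hp hmean).trans (le_of_eq ?_)) <;> ring

lemma sum_discountedMean_add_le (hf : Measurable fun p : X × S => f p.1 p.2)
    (hA : Measurable A) (hB : Measurable B) (hV : Measurable V)
    {D : Set X} (hD : ∀ p ∈ D, ∀ᵐ x ∂ν, f p x ∈ D)
    (hUfin : ∀ p ∈ D, β * ∫⁻ x, U (f p x) ∂ν ≠ ⊤) (hVfin : ∀ p ∈ D, β * ∫⁻ x, V (f p x) ∂ν ≠ ⊤)
    (hstep : ∀ p ∈ D, A p + V p + β * ∫⁻ x, U (f p x) ∂ν ≤ B p + U p + β * ∫⁻ x, V (f p x) ∂ν)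
    (T : ℕ) (hp : p ∈ D) :
    ∑ t ∈ Finset.range T, discountedMean f ν β A t p + V p ≤
      ∑ t ∈ Finset.range T, discountedMean f ν β B t p + U p + discountedMean f ν β V T p := by
  induction T generalizing p with
  | zero =>
    rw [discountedMean_zero, Finset.range_zero, Finset.sum_empty, Finset.sum_empty, zero_add]
    exact le_add_self
  | succ T ih =>
    have hnext := sum_discountedMean_add_le_succ (δ := 0) hf hA hB hV (hUfin p hp) (hVfin p hp)
      (by simpa using hstep p hp) ((hD p hp).mono fun x hx => ih hx)
    simpa using hnext

/-- The potentials telescope along the path, and the terminal term vanishes in the limit. -/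
lemma discountedSum_add_le_of_step (hf : Measurable fun p : X × S => f p.1 p.2)
    (hA : Measurable A) (hB : Measurable B) (hV : Measurable V)
    {D : Set X} (hD : ∀ p ∈ D, ∀ᵐ x ∂ν, f p x ∈ D)
    (hUfin : ∀ p ∈ D, β * ∫⁻ x, U (f p x) ∂ν ≠ ⊤) (hVfin : ∀ p ∈ D, β * ∫⁻ x, V (f p x) ∂ν ≠ ⊤)
    (hstep : ∀ p ∈ D, A p + V p + β * ∫⁻ x, U (f p x) ∂ν ≤ B p + U p + β * ∫⁻ x, V (f p x) ∂ν)
    (hp : p ∈ D) (hVsum : discountedSum f ν β V p ≠ ⊤)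
    (hδ : A p + V p + δ + β * ∫⁻ x, U (f p x) ∂ν ≤ B p + U p + β * ∫⁻ x, V (f p x) ∂ν) :
    discountedSum f ν β A p + V p + δ ≤ discountedSum f ν β B p + U p := by
  have hsucc (T : ℕ) := sum_discountedMean_add_le_succ (T := T) hf hA hB hV (hUfin p hp)
    (hVfin p hp) hδ ((hD p hp).mono fun _ hx =>
      sum_discountedMean_add_le hf hA hB hV hD hUfin hVfin hstep T hx)
  have hterminal : Tendsto (fun T => discountedMean f ν β V T p) atTop (𝓝 0) :=
    ENNReal.tendsto_atTop_zero_of_tsum_ne_top hVsum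
  have hlim := le_of_tendsto_of_tendsto'
    ((((tendsto_sum_discountedMean p).comp (tendsto_add_atTop_nat 1)).add
      tendsto_const_nhds).add tendsto_const_nhds)
    ((((tendsto_sum_discountedMean p).comp (tendsto_add_atTop_nat 1)).add
      tendsto_const_nhds).add (hterminal.comp (tendsto_add_atTop_nat 1))) hsucc
  rwa [add_zero] at hlim

end Discounted

lemma ofReal_add_ofReal_neg_add_gap_le {x y p q : ℝ} (hp : 0 ≤ p) (hq : 0 ≤ q)
    (h : y ≤ x + (q - p)) :
    ENNReal.ofReal y + ENNReal.ofReal (-x) + ENNReal.ofReal p + ENNReal.ofReal (x + (q - p) - y) ≤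
      ENNReal.ofReal x + ENNReal.ofReal (-y) + ENNReal.ofReal q := by
  have hpos (z : ℝ) : ENNReal.ofReal z = ENNReal.ofReal z⁺ := by
    rcases le_total z 0 with hz | hz
    · rw [posPart_of_nonpos hz, ENNReal.ofReal_zero, ENNReal.ofReal_of_nonpos hz]
    · rw [posPart_of_nonneg hz]
  have hneg (z : ℝ) : ENNReal.ofReal (-z) = ENNReal.ofReal z⁻ := by
    rw [hpos, posPart_neg]
  rw [hpos y, hneg x, hpos x, hneg y]
  rw [← ENNReal.ofReal_add (by positivity) (by positivity),
    ← ENNReal.ofReal_add (by positivity) hp, ← ENNReal.ofReal_add (by positivity) (by linarith),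
    ← ENNReal.ofReal_add (by positivity) (by positivity), ← ENNReal.ofReal_add (by positivity) hq]
  refine ENNReal.ofReal_le_ofReal ?_
  linarith [posPart_sub_negPart x, posPart_sub_negPart y]

lemma coe_sub_coe_le_coe_sub_coe {p q p' q' : ℝ≥0∞} (hq : q ≠ ⊤) (h : p + q ≤ p' + q') :
    (p : EReal) - q' ≤ p' - q := by
  rw [EReal.le_sub_iff_add_le (.inl (EReal.coe_ennreal_ne_bot _))
    (.inl (by simpa using hq))]
  rw [sub_eq_add_neg, add_right_comm, ← sub_eq_add_neg]
  exact EReal.sub_le_of_le_add (by exact_mod_cast h)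

lemma coe_sub_coe_lt_coe_sub_coe {p q p' q' : ℝ≥0∞} (hq : q ≠ ⊤) (h : p + q < p' + q') :
    (p : EReal) - q' < p' - q := by
  rw [EReal.lt_sub_iff_add_lt (.inl (EReal.coe_ennreal_ne_bot _))
    (.inl (by simpa using hq))]
  rw [sub_eq_add_neg, add_right_comm, ← sub_eq_add_neg]
  exact EReal.sub_lt_of_lt_add (by exact_mod_cast h)

lemma lt_tangent_of_strictConcaveOn {S : Set ℝ} {f : ℝ → ℝ} (hf : StrictConcaveOn ℝ S f) {x y : ℝ}
    (hx : x ∈ S) (hy : y ∈ S) (hyx : y ≠ x) (hfx : DifferentiableAt ℝ f x) :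
    f y < f x + deriv f x * (y - x) := by
  rcases hyx.lt_or_gt with hlt | hlt
  · have hslope := hf.deriv_lt_slope hy hx hlt hfx
    rw [slope_def_field, lt_div_iff₀ (sub_pos.2 hlt)] at hslope
    linarith
  · have hslope := hf.slope_lt_deriv hx hy hlt hfx
    rw [slope_def_field, div_lt_iff₀ (sub_pos.2 hlt)] at hslope
    linarith

namespace IncomeFluctuation

variable {m : ℕ} {Z : Set (EuclideanSpace ℝ (Fin m))} {E F : Type*}
  [MeasurableSpace E] [MeasurableSpace F] {M : IncomeFluctuation Z E F}

/-! ### Utility and marginal utility -/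

lemma marg_zero : M.marg 0 = ⊤ := if_pos rfl

lemma marg_of_pos {c : ℝ≥0} (hc : 0 < c) : M.marg c = ENNReal.ofReal (deriv M.uReal c) :=
  if_neg hc.ne'

lemma marg_ne_top {c : ℝ≥0} (hc : 0 < c) : M.marg c ≠ ⊤ := by
  rw [marg_of_pos hc]
  exact ENNReal.ofReal_ne_top

namespace UtilityAssumption

lemma deriv_strictAntiOn (hU : M.UtilityAssumption) :
    StrictAntiOn (deriv M.uReal) (Set.Ioi 0) :=
  strictAntiOn_of_deriv_neg (convex_Ioi 0) hU.differentiable_deriv.continuousOn fun c hc =>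
    hU.deriv_deriv_neg c (by simpa using hc)

lemma marg_strictAnti (hU : M.UtilityAssumption) : StrictAnti M.marg := by
  intro a b hab
  have hb : 0 < b := pos_of_gt hab
  rcases eq_zero_or_pos a with rfl | ha
  · rw [marg_zero]
    exact (marg_ne_top hb).lt_top
  · rw [marg_of_pos ha, marg_of_pos hb,
      ENNReal.ofReal_lt_ofReal_iff (hU.deriv_pos _ (NNReal.coe_pos.2 ha))]
    exact hU.deriv_strictAntiOn (NNReal.coe_pos.2 ha) (NNReal.coe_pos.2 hb)
      (NNReal.coe_lt_coe.2 hab)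

lemma marg_antitone (hU : M.UtilityAssumption) : Antitone M.marg := hU.marg_strictAnti.antitone

lemma measurable_marg (hU : M.UtilityAssumption) : Measurable M.marg := hU.marg_antitone.measurable

lemma continuousAt_marg_zero (hU : M.UtilityAssumption) : ContinuousAt M.marg 0 := by
  rw [ContinuousAt, marg_zero, ENNReal.tendsto_nhds_top_iff_nnreal]
  intro y
  obtain ⟨δ, hδ : 0 < δ, hlarge⟩ := mem_nhdsGT_iff_exists_Ioo_subset.1
    (tendsto_atTop.1 hU.tendsto_zero (y + 1))
  have hnhds : Set.Iio δ.toNNReal ∈ 𝓝 (0 : ℝ≥0) := Iio_mem_nhds (Real.toNNReal_pos.2 hδ)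
  filter_upwards [hnhds] with x hx
  rcases eq_zero_or_pos x with rfl | hx0
  · simp [marg_zero]
  · have hderiv : (y : ℝ) + 1 ≤ deriv M.uReal x :=
      hlarge ⟨NNReal.coe_pos.2 hx0, Real.lt_toNNReal_iff_coe_lt.1 hx⟩
    rw [marg_of_pos hx0, ENNReal.lt_ofReal_iff_toReal_lt ENNReal.coe_ne_top, ENNReal.coe_toReal]
    linarith

lemma continuous_marg (hU : M.UtilityAssumption) : Continuous M.marg := by
  rw [continuous_iff_continuousAt]
  intro c
  rcases eq_zero_or_pos c with rfl | hc
  · exact hU.continuousAt_marg_zero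
  · have hderiv : ContinuousAt (deriv M.uReal) (c : ℝ) :=
      hU.differentiable_deriv.continuousOn.continuousAt (Ioi_mem_nhds (NNReal.coe_pos.2 hc))
    have hofReal : ContinuousAt (fun x : ℝ≥0 => ENNReal.ofReal (deriv M.uReal x)) c :=
      ENNReal.continuous_ofReal.continuousAt.comp
        (hderiv.comp (f := fun x : ℝ≥0 => (x : ℝ)) NNReal.continuous_coe.continuousAt)
    refine hofReal.congr ?_
    filter_upwards [Ioi_mem_nhds hc] with x hx
    rw [marg_of_pos hx]

lemma marg_mul_self_le (hU : M.UtilityAssumption) (a : ℝ≥0) :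
    M.marg a * a ≤ M.marg 1 * a + M.marg a := by
  rcases le_total a 1 with ha | ha
  · calc M.marg a * a ≤ M.marg a * 1 := by gcongr; exact_mod_cast ha
      _ = M.marg a := mul_one _
      _ ≤ M.marg 1 * a + M.marg a := le_add_self
  · calc M.marg a * a ≤ M.marg 1 * a := by gcongr; exact hU.marg_antitone ha
      _ ≤ M.marg 1 * a + M.marg a := le_self_add

lemma coe_uReal (hU : M.UtilityAssumption) {c : ℝ≥0} (hc : 0 < c) :
    ((M.uReal c : ℝ) : EReal) = M.u c := by
  rw [uReal, Real.toNNReal_coe, EReal.coe_toReal (hU.ne_top c) (hU.ne_bot c hc)]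

lemma monotone_u (hU : M.UtilityAssumption) : Monotone M.u := by
  have huReal : StrictMonoOn M.uReal (Set.Ioi 0) :=
    strictMonoOn_of_deriv_pos (convex_Ioi 0) hU.differentiable.continuousOn fun c hc =>
      hU.deriv_pos c (by simpa using hc)
  intro a b hab
  rcases eq_zero_or_pos a with rfl | ha
  · exact hU.u_zero_le b
  · have hb := ha.trans_le hab
    rw [← hU.coe_uReal ha, ← hU.coe_uReal hb, EReal.coe_le_coe_iff]
    exact huReal.monotoneOn (NNReal.coe_pos.2 ha) (NNReal.coe_pos.2 hb) (NNReal.coe_le_coe.2 hab)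

lemma measurable_u (hU : M.UtilityAssumption) : Measurable M.u := hU.monotone_u.measurable

lemma strictConcaveOn_uReal (hU : M.UtilityAssumption) :
    StrictConcaveOn ℝ (Set.Ioi 0) M.uReal :=
  StrictAntiOn.strictConcaveOn_of_deriv (convex_Ioi 0) hU.differentiable.continuousOn
    (by simpa using hU.deriv_strictAntiOn)

lemma uReal_lt_tangent (hU : M.UtilityAssumption) {c d : ℝ} (hc : 0 < c) (hd : 0 < d)
    (hdc : d ≠ c) : M.uReal d < M.uReal c + deriv M.uReal c * (d - c) :=
  lt_tangent_of_strictConcaveOn hU.strictConcaveOn_uReal hc hd hdc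
    (hU.differentiable.differentiableAt (Ioi_mem_nhds hc))

lemma uReal_le_tangent (hU : M.UtilityAssumption) {c d : ℝ} (hc : 0 < c) (hd : 0 < d) :
    M.uReal d ≤ M.uReal c + deriv M.uReal c * (d - c) := by
  rcases eq_or_ne d c with rfl | hdc
  · simp
  · exact (hU.uReal_lt_tangent hc hd hdc).le

lemma lt_tangent_at_zero (hU : M.UtilityAssumption) {r : ℝ} (hr : ∀ x : ℝ, 0 < x → r ≤ M.uReal x)
    {c : ℝ} (hc : 0 < c) : r < M.uReal c + deriv M.uReal c * (0 - c) := by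
  have hle {b : ℝ} (hb : 0 < b) : r ≤ M.uReal b + deriv M.uReal b * (0 - b) := by
    refine le_of_forall_pos_le_add fun ε hε => ?_
    have hderiv := hU.deriv_pos b hb
    have htangent := (hr _ (div_pos hε hderiv)).trans
      (hU.uReal_le_tangent hb (div_pos hε hderiv))
    rw [mul_sub, mul_div_cancel₀ _ hderiv.ne'] at htangent
    linarith
  -- Strictness: the tangent at `c / 2` meets the axis below the tangent at `c`.
  have hhalf : 0 < c / 2 := half_pos hc
  have hderiv := hU.deriv_strictAntiOn (Set.mem_Ioi.2 hhalf) (Set.mem_Ioi.2 hc) (half_lt_self hc)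
  nlinarith [hle hhalf, hU.uReal_le_tangent hc hhalf]

lemma toReal_u_lt_tangent (hU : M.UtilityAssumption) {c d : ℝ≥0} (hc : 0 < c) (hdc : d ≠ c)
    (hd : M.u d ≠ ⊥) : (M.u d).toReal < M.uReal c + deriv M.uReal c * (d - c) := by
  have hc' : (0 : ℝ) < c := NNReal.coe_pos.2 hc
  rcases eq_zero_or_pos d with rfl | hd0
  · refine hU.lt_tangent_at_zero (fun x _ => ?_) hc'
    exact EReal.toReal_le_toReal (hU.u_zero_le _) hd (hU.ne_top _)
  · simpa only [uReal, Real.toNNReal_coe] using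
      hU.uReal_lt_tangent hc' (NNReal.coe_pos.2 hd0) (NNReal.coe_injective.ne hdc)

/-- Strict concavity, with both sides moved so that no subtraction of positive and negative parts
occurs. -/
lemma exists_concavity_gap (hU : M.UtilityAssumption) {c : ℝ≥0} (hc : 0 < c) (d : ℝ≥0) :
    ∃ δ : ℝ≥0∞, (d ≠ c → 0 < δ) ∧
      (M.u d).toENNReal + (-M.u c).toENNReal + M.marg c * c + δ ≤
        (M.u c).toENNReal + (-M.u d).toENNReal + M.marg c * d := by
  rcases eq_or_ne d c with rfl | hdc
  · exact ⟨0, fun h => absurd rfl h, by rw [add_zero, add_comm (M.u d).toENNReal]⟩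
  by_cases hd : M.u d = ⊥
  · exact ⟨1, fun _ => one_pos, by simp [hd]⟩
  have hderiv : 0 < deriv M.uReal c := hU.deriv_pos c (NNReal.coe_pos.2 hc)
  have hmul (e : ℝ≥0) : M.marg c * e = ENNReal.ofReal (deriv M.uReal c * e) := by
    rw [marg_of_pos hc, ENNReal.ofReal_mul hderiv.le, ENNReal.ofReal_coe_nnreal]
  have htangent := hU.toReal_u_lt_tangent hc hdc hd
  rw [mul_sub] at htangent
  refine ⟨ENNReal.ofReal (M.uReal c + (deriv M.uReal c * d - deriv M.uReal c * c) -
    (M.u d).toReal), fun _ => ENNReal.ofReal_pos.2 (sub_pos.2 htangent), ?_⟩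
  rw [← hU.coe_uReal hc, ← EReal.coe_toReal (hU.ne_top d) hd, hmul, hmul, ← EReal.coe_neg,
    ← EReal.coe_neg]
  simp only [EReal.toENNReal_of_ne_top (EReal.coe_ne_top _), EReal.toReal_coe]
  exact ofReal_add_ofReal_neg_add_gap_le (by positivity) (by positivity) htangent.le

lemma toENNReal_u_of_pos (hU : M.UtilityAssumption) {c : ℝ≥0} (hc : 0 < c) :
    (M.u c).toENNReal = ENNReal.ofReal (M.uReal c) := by
  rw [← hU.coe_uReal hc, EReal.toENNReal_of_ne_top (EReal.coe_ne_top _), EReal.toReal_coe]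

lemma toENNReal_u_le (hU : M.UtilityAssumption) (c : ℝ≥0) :
    (M.u c).toENNReal ≤ ENNReal.ofReal |M.uReal 1| + M.marg 1 * c := by
  have hderiv : 0 < deriv M.uReal 1 := hU.deriv_pos 1 one_pos
  rcases eq_zero_or_pos c with rfl | hc
  · calc (M.u 0).toENNReal ≤ (M.u 1).toENNReal := EReal.toENNReal_le_toENNReal (hU.u_zero_le 1)
      _ = ENNReal.ofReal (M.uReal 1) := by
          simpa using hU.toENNReal_u_of_pos (c := 1) one_pos
      _ ≤ ENNReal.ofReal |M.uReal 1| := ENNReal.ofReal_le_ofReal (le_abs_self _)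
      _ ≤ ENNReal.ofReal |M.uReal 1| + M.marg 1 * (0 : ℝ≥0) := le_self_add
  · have htangent := hU.uReal_le_tangent one_pos (NNReal.coe_pos.2 hc)
    rw [hU.toENNReal_u_of_pos hc, marg_of_pos one_pos, NNReal.coe_one, ← ENNReal.ofReal_coe_nnreal,
      ← ENNReal.ofReal_mul hderiv.le, ← ENNReal.ofReal_add (abs_nonneg _) (by positivity)]
    refine ENNReal.ofReal_le_ofReal ?_
    linarith [le_abs_self (M.uReal 1)]

lemma toENNReal_neg_u_le (hU : M.UtilityAssumption) (c : ℝ≥0) :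
    (-M.u c).toENNReal ≤ ENNReal.ofReal |M.uReal 1| + M.marg c := by
  rcases eq_zero_or_pos c with rfl | hc
  · simp [marg_zero]
  · have hc' : (0 : ℝ) < c := NNReal.coe_pos.2 hc
    have htangent := hU.uReal_le_tangent hc' one_pos
    have hderiv := hU.deriv_pos c hc'
    rw [← hU.coe_uReal hc, ← EReal.coe_neg, EReal.toENNReal_of_ne_top (EReal.coe_ne_top _),
      EReal.toReal_coe, marg_of_pos hc, ← ENNReal.ofReal_add (abs_nonneg _) hderiv.le]
    refine ENNReal.ofReal_le_ofReal ?_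
    nlinarith [neg_abs_le (M.uReal 1)]

end UtilityAssumption

/-- The assumptions that optimality and stability rest on. Moments are those of one period: for
iid shocks `E R_1 ⋯ R_n = (E R)^n`. -/
structure StabilityAssumptions (M : IncomeFluctuation Z E F) : Prop where
  utility : M.UtilityAssumption
  β_mul_ret_lt_one : (M.β : ℝ≥0∞) * ∫⁻ x, (M.ret x : ℝ≥0∞) ∂M.shockLaw < 1
  inc_finite : ∫⁻ x, (M.inc x : ℝ≥0∞) ∂M.shockLaw < ⊤
  marg_finite : ∫⁻ x, M.marg (M.inc x) ∂M.shockLaw < ⊤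
  ret_marg_finite : ∫⁻ x, (M.ret x : ℝ≥0∞) * M.marg (M.inc x) ∂M.shockLaw < ⊤
  consumption_rate : ∃ α : ℝ≥0, 0 < α ∧ α < 1 ∧
    (∀ a : ℝ≥0, 0 < a →
      (M.β : ℝ≥0∞) * ∫⁻ x, (M.ret x : ℝ≥0∞) * M.marg (M.ret x * (1 - α) * a) ∂M.shockLaw
        ≤ M.marg a) ∧
    ((1 - α : ℝ≥0) : ℝ≥0∞) * ∫⁻ x, (M.ret x : ℝ≥0∞) ∂M.shockLaw < 1

lemma mul_ret_lt_one_of_pow {b : ℝ≥0∞}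
    (hb : ∃ n : ℕ, b ^ n * ∫⁻ w, ∏ i ∈ Finset.range n, (M.ret (w i) : ℝ≥0∞) ∂M.seqLaw < 1) :
    b * ∫⁻ x, (M.ret x : ℝ≥0∞) ∂M.shockLaw < 1 := by
  obtain ⟨n, hn⟩ := hb
  rw [seqLaw, lintegral_infinitePi_prod_range M.shockLaw M.measurable_ret.coe_nnreal_ennreal,
    ← mul_pow] at hn
  by_contra! hle
  exact (one_le_pow₀ hle).not_gt hn

lemma Assumptions.stability (hM : M.Assumptions) : M.StabilityAssumptions where
  utility := hM.utility
  β_mul_ret_lt_one := mul_ret_lt_one_of_pow hM.contraction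
  inc_finite := by
    have heval := (measurePreserving_eval_infinitePi (fun _ : ℕ => M.shockLaw) 0).lintegral_comp
      M.measurable_inc.coe_nnreal_ennreal
    exact heval ▸ (le_iSup _ 0).trans_lt hM.income_bounded
  marg_finite := hM.marg_finite
  ret_marg_finite := hM.ret_marg_finite
  consumption_rate := by
    obtain ⟨α, hα0, hα1, hα, hret⟩ := hM.consumption_rate
    exact ⟨α, hα0, hα1, hα, mul_ret_lt_one_of_pow hret⟩

namespace StabilityAssumptions

lemma ret_finite (hM : M.StabilityAssumptions) :
    ∫⁻ x, (M.ret x : ℝ≥0∞) ∂M.shockLaw ≠ ⊤ := by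
  obtain ⟨α, -, hα, -, hret⟩ := hM.consumption_rate
  intro htop
  rw [htop, ENNReal.mul_top (by exact_mod_cast (tsub_pos_of_lt hα).ne')] at hret
  exact not_top_lt hret

lemma inc_pos_ae (hM : M.StabilityAssumptions) : ∀ᵐ x ∂M.shockLaw, 0 < M.inc x := by
  filter_upwards [ae_lt_top (hM.utility.measurable_marg.comp M.measurable_inc) hM.marg_finite.ne]
    with x hx
  rw [pos_iff_ne_zero]
  intro hzero
  simp [hzero, marg_zero] at hx

end StabilityAssumptions

end IncomeFluctuation

namespace IncomeFluctuation

variable {m : ℕ} {Z : Set (EuclideanSpace ℝ (Fin m))} {E F : Type*}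
  [MeasurableSpace E] [MeasurableSpace F] {M : IncomeFluctuation Z E F}

/-! ### The Euler equation -/

/-- The expected discounted marginal utility of savings `s` when next period's consumption is
given by `c`. -/
noncomputable def margVal (M : IncomeFluctuation Z E F) (c : ℝ≥0 → ℝ≥0) (s : ℝ≥0) : ℝ≥0∞ :=
  M.β * ∫⁻ x, (M.ret x : ℝ≥0∞) * M.marg (c (M.ret x * s + M.inc x)) ∂M.shockLaw

lemma margVal_le_margVal (hU : M.UtilityAssumption) {c d : ℝ≥0 → ℝ≥0} (hcd : c ≤ d) (s : ℝ≥0) :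
    M.margVal d s ≤ M.margVal c s := by
  unfold margVal
  gcongr with x
  exact hU.marg_antitone (hcd _)

lemma antitone_margVal (hU : M.UtilityAssumption) {c : ℝ≥0 → ℝ≥0} (hc : Monotone c) :
    Antitone (M.margVal c) := by
  intro s t hst
  unfold margVal
  gcongr with x
  exact hU.marg_antitone (hc (by gcongr))

/-- Time iteration (Coleman's operator) on marginal values of savings: the consumption rule that
equates marginal utility with `g` in turn determines a marginal value of savings. -/
noncomputable def timeIter (hU : M.UtilityAssumption) : (ℝ≥0 → ℝ≥0∞) →o (ℝ≥0 → ℝ≥0∞) where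
  toFun g := M.margVal (consumption M.marg g)
  monotone' _ _ hgg' s := margVal_le_margVal hU (consumption_le_consumption hgg') s

/-- The marginal value of savings that solves the Euler equation: the least fixed point of time
iteration. -/
noncomputable def margValStar (hU : M.UtilityAssumption) : ℝ≥0 → ℝ≥0∞ := (timeIter hU).lfp

lemma margVal_consumption_margValStar (hU : M.UtilityAssumption) :
    M.margVal (consumption M.marg (margValStar hU)) = margValStar hU :=
  (timeIter hU).map_lfp

lemma margValStar_le (hU : M.UtilityAssumption) {g : ℝ≥0 → ℝ≥0∞}
    (hg : M.margVal (consumption M.marg g) ≤ g) : margValStar hU ≤ g :=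
  (timeIter hU).lfp_le hg

lemma antitone_margValStar (hU : M.UtilityAssumption) : Antitone (margValStar hU) := by
  refine OrderHom.lfp_induction (timeIter hU) (p := Antitone)
    (fun g hg _ => antitone_margVal hU (monotone_consumption hg)) fun G hG a b hab => ?_
  rw [sSup_apply, sSup_apply]
  exact iSup_mono fun g => hG g.1 g.2 hab

lemma ret_mul_marg_consumption_le (hU : M.UtilityAssumption) {g : ℝ≥0 → ℝ≥0∞} (hg : Antitone g)
    {K : ℝ≥0∞} (hK : g 0 ≤ K) (s : ℝ≥0) (x : Z × E × F) :
    (M.ret x : ℝ≥0∞) * M.marg (consumption M.marg g (M.ret x * s + M.inc x)) ≤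
      M.ret x * M.marg (M.inc x) + M.ret x * K := by
  rw [← mul_add]
  gcongr
  refine (apply_consumption_le_max hU.marg_antitone hU.continuous_marg hg _).trans (max_le ?_ ?_)
  · exact (hU.marg_antitone le_add_self).trans le_self_add
  · exact hK.trans le_add_self

namespace StabilityAssumptions

lemma exists_margValStar_le (hM : M.StabilityAssumptions) :
    ∃ K : ℝ≥0∞, K ≠ ⊤ ∧ ∀ s, margValStar hM.utility s ≤ K := by
  set ρ := (M.β : ℝ≥0∞) * ∫⁻ x, (M.ret x : ℝ≥0∞) ∂M.shockLaw
  set L := (M.β : ℝ≥0∞) * ∫⁻ x, (M.ret x : ℝ≥0∞) * M.marg (M.inc x) ∂M.shockLaw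
  have hρ : ρ < 1 := hM.β_mul_ret_lt_one
  have hL : L ≠ ⊤ := ENNReal.mul_ne_top ENNReal.coe_ne_top hM.ret_marg_finite.ne
  refine ⟨L / (1 - ρ), ENNReal.div_ne_top hL (tsub_pos_of_lt hρ).ne',
    margValStar_le hM.utility (g := fun _ => L / (1 - ρ)) fun s => ?_⟩
  set K := L / (1 - ρ)
  have hret := M.measurable_ret.coe_nnreal_ennreal
  calc M.margVal (consumption M.marg fun _ => K) s
      ≤ M.β * ∫⁻ x, ((M.ret x : ℝ≥0∞) * M.marg (M.inc x) + (M.ret x : ℝ≥0∞) * K) ∂M.shockLaw :=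
        mul_le_mul_right (lintegral_mono fun x =>
          ret_mul_marg_consumption_le hM.utility antitone_const le_rfl s x) _
    _ = L + ρ * K := by
        rw [lintegral_add_right _ (hret.mul_const K), lintegral_mul_const _ hret, mul_add,
          ← mul_assoc]
    _ = K := ennreal_add_mul_div_one_sub hρ L

lemma continuous_margValStar (hM : M.StabilityAssumptions) :
    Continuous (margValStar hM.utility) := by
  have hU := hM.utility
  have hanti := antitone_margValStar hU
  obtain ⟨K, hK, hle⟩ := hM.exists_margValStar_le
  have hret := M.measurable_ret.coe_nnreal_ennreal
  have hcont := hU.continuous_marg.comp (continuous_consumption hU.marg_antitone hanti)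
  rw [← margVal_consumption_margValStar hU, continuous_iff_continuousAt]
  intro s
  refine ENNReal.Tendsto.const_mul ?_ (.inr ENNReal.coe_ne_top)
  refine tendsto_lintegral_filter_of_dominated_convergence
    (fun x => (M.ret x : ℝ≥0∞) * M.marg (M.inc x) + (M.ret x : ℝ≥0∞) * K) ?_ ?_ ?_ ?_
  · exact .of_forall fun t => hret.mul
      (hcont.measurable.comp ((M.measurable_ret.mul_const t).add M.measurable_inc))
  · exact .of_forall fun t => .of_forall fun x => ret_mul_marg_consumption_le hU hanti (hle 0) t x
  · rw [lintegral_add_right _ (hret.mul_const K), lintegral_mul_const _ hret]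
    exact ENNReal.add_ne_top.2 ⟨hM.ret_marg_finite.ne, ENNReal.mul_ne_top hM.ret_finite hK⟩
  · refine .of_forall fun x => ENNReal.Tendsto.const_mul ?_ (.inr ENNReal.coe_ne_top)
    exact (hcont.comp ((continuous_const.mul continuous_id).add continuous_const)).tendsto s

end StabilityAssumptions

lemma mul_le_consumption_margValStar (hU : M.UtilityAssumption) {α : ℝ≥0} (hα0 : 0 < α)
    (hα1 : α < 1)
    (hα : ∀ a : ℝ≥0, 0 < a →
      (M.β : ℝ≥0∞) * ∫⁻ x, (M.ret x : ℝ≥0∞) * M.marg (M.ret x * (1 - α) * a) ∂M.shockLaw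
        ≤ M.marg a) (a : ℝ≥0) :
    α * a ≤ consumption M.marg (margValStar hU) a := by
  have hα1' : 0 < 1 - α := tsub_pos_of_lt hα1
  refine (mul_le_consumption hα1 hU.marg_strictAnti a).trans
    (consumption_le_consumption (margValStar_le hU fun s => ?_) a)
  rcases eq_zero_or_pos s with rfl | hs
  · simp [marg_zero]
  · refine le_trans ?_ (hα (α / (1 - α) * s) (by positivity))
    unfold margVal
    gcongr with x
    refine hU.marg_antitone (le_trans ?_ (mul_le_consumption hα1 hU.marg_strictAnti _))
    calc M.ret x * (1 - α) * (α / (1 - α) * s) = α * (M.ret x * s) := by field_simp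
      _ ≤ α * (M.ret x * s + M.inc x) := by gcongr; exact le_self_add

/-- A policy, as a function of wealth, that solves the Euler equation and consumes at least a
fixed share `α` of wealth, where `(1 - α) E R < 1`. -/
structure EulerPolicy (M : IncomeFluctuation Z E F) (c : ℝ≥0 → ℝ≥0) : Prop where
  continuous : Continuous c
  mono : Monotone c
  le : ∀ a, c a ≤ a
  savings_mono : Monotone fun a => a - c a
  rate : ∃ α : ℝ≥0, 0 < α ∧ ((1 - α : ℝ≥0) : ℝ≥0∞) * ∫⁻ x, (M.ret x : ℝ≥0∞) ∂M.shockLaw < 1 ∧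
    ∀ a, α * a ≤ c a
  margVal_zero_ne_top : M.margVal c 0 ≠ ⊤
  marg_le : ∀ a, M.marg (c a) ≤ max (M.marg a) (M.margVal c 0)
  euler_le : ∀ a, M.margVal c (a - c a) ≤ M.marg (c a)
  euler_ge : ∀ a, 0 < a - c a → M.marg (c a) ≤ M.margVal c (a - c a)

theorem StabilityAssumptions.exists_eulerPolicy (hM : M.StabilityAssumptions) :
    ∃ c, M.EulerPolicy c := by
  have hU := hM.utility
  have hmarg := hU.marg_antitone
  have hanti := antitone_margValStar hU
  have hcont := hM.continuous_margValStar
  obtain ⟨K, hK, hle⟩ := hM.exists_margValStar_le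
  obtain ⟨α, hα0, hα1, hα, hret⟩ := hM.consumption_rate
  exact ⟨consumption M.marg (margValStar hU), {
    continuous := continuous_consumption hmarg hanti
    mono := monotone_consumption hanti
    le := fun _ => tsub_le_self
    savings_mono := by
      simpa only [sub_consumption] using monotone_savings hmarg (margValStar hU)
    rate := ⟨α, hα0, hret, mul_le_consumption_margValStar hU hα0 hα1 hα⟩
    margVal_zero_ne_top := by
      simpa only [margVal_consumption_margValStar] using ne_top_of_le_ne_top hK (hle 0)
    marg_le := by
      simpa only [margVal_consumption_margValStar] using
        apply_consumption_le_max hmarg hU.continuous_marg hanti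
    euler_le := by
      simpa only [margVal_consumption_margValStar, sub_consumption] using
        le_apply_consumption hU.continuous_marg marg_zero hcont
    euler_ge := by
      simpa only [margVal_consumption_margValStar, sub_consumption] using fun _ =>
        apply_consumption_le_of_savings_pos hmarg hU.continuous_marg hanti hcont le_rfl }⟩

namespace EulerPolicy

variable {c : ℝ≥0 → ℝ≥0}

lemma pos (hc : M.EulerPolicy c) {a : ℝ≥0} (ha : 0 < a) : 0 < c a := by
  obtain ⟨α, hα, -, hle⟩ := hc.rate
  exact (mul_pos hα ha).trans_le (hle a)

lemma marg_le_add (hc : M.EulerPolicy c) (a : ℝ≥0) :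
    M.marg (c a) ≤ M.marg a + M.margVal c 0 :=
  (hc.marg_le a).trans (max_le le_self_add le_add_self)

lemma candidate (hU : M.UtilityAssumption) (hc : M.EulerPolicy c) :
    M.Candidate fun s => c s.1 where
  continuousOn := (hc.continuous.comp continuous_fst).continuousOn
  mono _ := hc.mono
  pos _ _ ha := hc.pos ha
  le a _ := hc.le a
  bounded := by
    refine ⟨(M.margVal c 0).toReal, fun a _ ha => ?_⟩
    have ha' : (0 : ℝ) < a := NNReal.coe_pos.2 ha
    have hle : deriv M.uReal a ≤ deriv M.uReal (c a) :=
      hU.deriv_strictAntiOn.antitoneOn (NNReal.coe_pos.2 (hc.pos ha)) ha'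
        (NNReal.coe_le_coe.2 (hc.le a))
    have hge := hc.marg_le_add a
    rw [marg_of_pos (hc.pos ha), marg_of_pos ha, ENNReal.ofReal_le_iff_le_toReal
      (ENNReal.add_ne_top.2 ⟨ENNReal.ofReal_ne_top, hc.margVal_zero_ne_top⟩),
      ENNReal.toReal_add ENNReal.ofReal_ne_top hc.margVal_zero_ne_top,
      ENNReal.toReal_ofReal (hU.deriv_pos _ ha').le] at hge
    rw [abs_of_nonneg (sub_nonneg.2 hle)]
    linarith

lemma feasible (hc : M.EulerPolicy c) : Feasible fun s : ℝ≥0 × Z => c s.1 where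
  measurable := hc.continuous.measurable.comp measurable_fst
  le a _ := hc.le a

end EulerPolicy

end IncomeFluctuation
namespace IncomeFluctuation

variable {m : ℕ} {Z : Set (EuclideanSpace ℝ (Fin m))} {E F : Type*}
  [MeasurableSpace E] [MeasurableSpace F] {M : IncomeFluctuation Z E F} {d : ℝ≥0 × Z → ℝ≥0}
  {s : ℝ≥0 × Z}

/-! ### Optimality of solutions to the Euler equation -/

/-- Next period's state under a policy that may depend on the exogenous state. -/
def nextState (M : IncomeFluctuation Z E F) (d : ℝ≥0 × Z → ℝ≥0) (s : ℝ≥0 × Z) (x : Z × E × F) :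
    ℝ≥0 × Z :=
  (M.ret x * (s.1 - d s) + M.inc x, x.1)

lemma statePath_eq_iterPath (d : ℝ≥0 × Z → ℝ≥0) (s : ℝ≥0 × Z) (w : ℕ → Z × E × F) (t : ℕ) :
    M.statePath d s w t = iterPath (M.nextState d) s w t := by
  induction t with
  | zero => rfl
  | succ t ih => rw [statePath, ih]; rfl

lemma measurable_nextState (hd : Measurable d) :
    Measurable fun p : (ℝ≥0 × Z) × (Z × E × F) => M.nextState d p.1 p.2 :=
  (((M.measurable_ret.comp measurable_snd).mul
    ((measurable_fst.comp measurable_fst).sub (hd.comp measurable_fst))).add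
      (M.measurable_inc.comp measurable_snd)).prodMk (measurable_fst.comp measurable_snd)

/-- Positive part of the flow utility of a policy. -/
noncomputable def utilityPos (M : IncomeFluctuation Z E F) (d : ℝ≥0 × Z → ℝ≥0) (s : ℝ≥0 × Z) :
    ℝ≥0∞ :=
  (M.u (d s)).toENNReal

/-- Negative part of the flow utility of a policy. -/
noncomputable def utilityNeg (M : IncomeFluctuation Z E F) (d : ℝ≥0 × Z → ℝ≥0) (s : ℝ≥0 × Z) :
    ℝ≥0∞ :=
  (-M.u (d s)).toENNReal

lemma UtilityAssumption.measurable_utilityPos (hU : M.UtilityAssumption) (hd : Measurable d) :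
    Measurable (M.utilityPos d) :=
  (hU.measurable_u.comp hd).ereal_toENNReal

lemma UtilityAssumption.measurable_utilityNeg (hU : M.UtilityAssumption) (hd : Measurable d) :
    Measurable (M.utilityNeg d) :=
  (hU.measurable_u.comp hd).neg.ereal_toENNReal

/-- The expected discounted sum of `φ` along the state path generated by `d`. -/
noncomputable def discountedValue (M : IncomeFluctuation Z E F) (d : ℝ≥0 × Z → ℝ≥0)
    (φ : ℝ≥0 × Z → ℝ≥0∞) (s : ℝ≥0 × Z) : ℝ≥0∞ :=
  discountedSum (M.nextState d) M.shockLaw M.β φ s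

lemma lifetimeValue_eq (hU : M.UtilityAssumption) (hd : Measurable d) (s : ℝ≥0 × Z) :
    M.lifetimeValue d s = (M.discountedValue d (M.utilityPos d) s : EReal) -
      (M.discountedValue d (M.utilityNeg d) s : EReal) := by
  rw [discountedValue, discountedValue, ← lintegral_tsum_eq_discountedSum (measurable_nextState hd)
    (hU.measurable_utilityPos hd), ← lintegral_tsum_eq_discountedSum (measurable_nextState hd)
    (hU.measurable_utilityNeg hd)]
  simp only [lifetimeValue, statePath_eq_iterPath, seqLaw, utilityPos, utilityNeg]

/-- A bound for the growth of all flow payoffs: near zero wealth marginal utility dominates,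
for large wealth the linear term. -/
noncomputable def growthBound (M : IncomeFluctuation Z E F) (s : ℝ≥0 × Z) : ℝ≥0∞ :=
  1 + (s.1 : ℝ≥0∞) + M.marg s.1

lemma one_le_growthBound (s : ℝ≥0 × Z) : 1 ≤ M.growthBound s :=
  le_self_add.trans le_self_add

lemma wealth_le_growthBound (s : ℝ≥0 × Z) : s.1 ≤ M.growthBound s :=
  le_add_self.trans le_self_add

lemma marg_le_growthBound (s : ℝ≥0 × Z) : M.marg s.1 ≤ M.growthBound s := le_add_self

lemma UtilityAssumption.measurable_growthBound (hU : M.UtilityAssumption) :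
    Measurable M.growthBound :=
  (measurable_const.add measurable_fst.coe_nnreal_ennreal).add
    (hU.measurable_marg.comp measurable_fst)

lemma UtilityAssumption.lintegral_nextState_le (hU : M.UtilityAssumption) (d : ℝ≥0 × Z → ℝ≥0)
    (s : ℝ≥0 × Z) (κ q : ℝ≥0∞) :
    ∫⁻ x, (κ + q * (M.nextState d s x).1 + M.marg (M.nextState d s x).1) ∂M.shockLaw ≤
      κ + q * ((∫⁻ x, (M.ret x : ℝ≥0∞) ∂M.shockLaw) * s.1 +
        ∫⁻ x, (M.inc x : ℝ≥0∞) ∂M.shockLaw) + ∫⁻ x, M.marg (M.inc x) ∂M.shockLaw := by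
  have hr := M.measurable_ret.coe_nnreal_ennreal
  have hy := M.measurable_inc.coe_nnreal_ennreal
  have hm : Measurable fun x => M.marg (M.inc x) := hU.measurable_marg.comp M.measurable_inc
  have hry : Measurable fun x => (M.ret x : ℝ≥0∞) * s.1 + M.inc x := (hr.mul_const _).add hy
  calc ∫⁻ x, (κ + q * (M.nextState d s x).1 + M.marg (M.nextState d s x).1) ∂M.shockLaw
      ≤ ∫⁻ x, (κ + q * ((M.ret x : ℝ≥0∞) * s.1 + M.inc x) + M.marg (M.inc x)) ∂M.shockLaw := by
        refine lintegral_mono fun x => ?_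
        simp only [nextState]
        gcongr
        · push_cast
          gcongr
          exact tsub_le_self
        · exact hU.marg_antitone le_add_self
    _ = _ := by
        rw [lintegral_add_right _ hm, lintegral_add_left measurable_const,
          lintegral_const_mul _ hry, lintegral_add_right _ hy,
          lintegral_mul_const _ hr, lintegral_const, measure_univ, mul_one]

-- `κ + q a + u'(a)` is a supersolution once `q = 1 + β E R q` and
-- `κ = 1 + β (q E Y + E u'(Y)) + β κ`.
lemma StabilityAssumptions.discountedValue_growthBound_ne_top (hM : M.StabilityAssumptions)
    (hd : Measurable d) (hs : 0 < s.1) : M.discountedValue d M.growthBound s ≠ ⊤ := by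
  set ER := ∫⁻ x, (M.ret x : ℝ≥0∞) ∂M.shockLaw
  set EY := ∫⁻ x, (M.inc x : ℝ≥0∞) ∂M.shockLaw
  set EU := ∫⁻ x, M.marg (M.inc x) ∂M.shockLaw
  have hρ : M.β * ER < 1 := hM.β_mul_ret_lt_one
  have hβ : (M.β : ℝ≥0∞) < 1 := by exact_mod_cast M.β_lt_one
  set q := 1 / (1 - M.β * ER)
  have hq_ne_top : q ≠ ⊤ := ENNReal.div_ne_top ENNReal.one_ne_top (tsub_pos_of_lt hρ).ne'
  have hq_eq : 1 + M.β * ER * q = q := ennreal_add_mul_div_one_sub hρ 1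
  set L := 1 + M.β * (q * EY + EU) with hL
  have hL_ne_top : L ≠ ⊤ := by
    have hEY_ne_top : EY ≠ ⊤ := hM.inc_finite.ne
    have hEU_ne_top : EU ≠ ⊤ := hM.marg_finite.ne
    finiteness
  set κ := L / (1 - M.β)
  have hκ_ne_top : κ ≠ ⊤ := ENNReal.div_ne_top hL_ne_top (tsub_pos_of_lt hβ).ne'
  have hκ_eq : L + M.β * κ = κ := ennreal_add_mul_div_one_sub hβ L
  have hsuper (s : ℝ≥0 × Z) : M.growthBound s + M.β * ∫⁻ x, (κ + q * (M.nextState d s x).1 +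
      M.marg (M.nextState d s x).1) ∂M.shockLaw ≤ κ + q * s.1 + M.marg s.1 :=
    calc _ ≤ 1 + (s.1 : ℝ≥0∞) + M.marg s.1 + M.β * (κ + q * (ER * s.1 + EY) + EU) := by
          unfold growthBound
          gcongr
          exact hM.utility.lintegral_nextState_le d s κ q
      _ = (L + M.β * κ) + (1 + M.β * ER * q) * s.1 + M.marg s.1 := by rw [hL]; ring
      _ = κ + q * s.1 + M.marg s.1 := by rw [hκ_eq, hq_eq]
  have hmarg_ne_top : M.marg s.1 ≠ ⊤ := marg_ne_top hs
  have hbound_ne_top : κ + q * s.1 + M.marg s.1 ≠ ⊤ := by finiteness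
  exact ne_top_of_le_ne_top hbound_ne_top (discountedSum_le_of_supersolution
    (measurable_nextState hd) hM.utility.measurable_growthBound
    (Φ := fun s => κ + q * s.1 + M.marg s.1) hsuper s)

lemma StabilityAssumptions.discountedValue_ne_top (hM : M.StabilityAssumptions)
    (hd : Measurable d) (hs : 0 < s.1) {φ : ℝ≥0 × Z → ℝ≥0∞} {C : ℝ≥0∞} (hC : C ≠ ⊤)
    (hφ : ∀ s, φ s ≤ C * M.growthBound s) : M.discountedValue d φ s ≠ ⊤ :=
  discountedSum_ne_top_of_le (measurable_nextState hd) hM.utility.measurable_growthBound hC hφ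
    (hM.discountedValue_growthBound_ne_top hd hs)

lemma StabilityAssumptions.discountedValue_utilityPos_ne_top (hM : M.StabilityAssumptions)
    (hd : Feasible d) (hs : 0 < s.1) : M.discountedValue d (M.utilityPos d) s ≠ ⊤ := by
  have hmarg_ne_top : M.marg 1 ≠ ⊤ := marg_ne_top one_pos
  refine hM.discountedValue_ne_top hd.measurable hs
    (C := ENNReal.ofReal |M.uReal 1| + M.marg 1) (by finiteness) fun s => ?_
  calc M.utilityPos d s ≤ ENNReal.ofReal |M.uReal 1| * 1 + M.marg 1 * d s := by
        rw [mul_one]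
        exact hM.utility.toENNReal_u_le _
    _ ≤ ENNReal.ofReal |M.uReal 1| * M.growthBound s + M.marg 1 * M.growthBound s := by
        gcongr
        · exact one_le_growthBound s
        · exact le_trans (by exact_mod_cast hd.le s.1 s.2) (wealth_le_growthBound s)
    _ = _ := (add_mul _ _ _).symm

/-- Joint transition of the states of two agents who face the same shocks, the first of whom
follows the wealth-only policy `c` and the second the policy `d`. -/
def nextPair (M : IncomeFluctuation Z E F) (c : ℝ≥0 → ℝ≥0) (d : ℝ≥0 × Z → ℝ≥0)
    (p : (ℝ≥0 × Z) × (ℝ≥0 × Z)) (x : Z × E × F) : (ℝ≥0 × Z) × (ℝ≥0 × Z) :=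
  (M.nextState (fun s => c s.1) p.1 x, M.nextState d p.2 x)

/-- The wealth `a'` valued at the marginal utility of consuming `c(a)`. -/
noncomputable def crossValue (M : IncomeFluctuation Z E F) (c : ℝ≥0 → ℝ≥0) (a a' : ℝ≥0) : ℝ≥0∞ :=
  M.marg (c a) * a'

variable {c : ℝ≥0 → ℝ≥0}

lemma measurable_nextPair (hc : Measurable c) (hd : Measurable d) :
    Measurable fun q : ((ℝ≥0 × Z) × (ℝ≥0 × Z)) × (Z × E × F) => M.nextPair c d q.1 q.2 :=
  ((measurable_nextState (hc.comp measurable_fst)).comp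
    ((measurable_fst.comp measurable_fst).prodMk measurable_snd)).prodMk
    ((measurable_nextState hd).comp ((measurable_snd.comp measurable_fst).prodMk measurable_snd))

lemma discountedSum_nextPair_fst (φ : ℝ≥0 × Z → ℝ≥0∞) (p : (ℝ≥0 × Z) × (ℝ≥0 × Z)) :
    discountedSum (M.nextPair c d) M.shockLaw M.β (fun p => φ p.1) p =
      M.discountedValue (fun s => c s.1) φ p.1 :=
  discountedSum_comp (fun _ _ => rfl) φ p

lemma discountedSum_nextPair_snd (φ : ℝ≥0 × Z → ℝ≥0∞) (p : (ℝ≥0 × Z) × (ℝ≥0 × Z)) :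
    discountedSum (M.nextPair c d) M.shockLaw M.β (fun p => φ p.2) p =
      M.discountedValue d φ p.2 :=
  discountedSum_comp (fun _ _ => rfl) φ p

lemma UtilityAssumption.measurable_crossValue_self (hU : M.UtilityAssumption) (hc : Measurable c) :
    Measurable fun a => M.crossValue c a a :=
  (hU.measurable_marg.comp hc).mul measurable_coe_nnreal_ennreal

lemma UtilityAssumption.β_mul_lintegral_crossValue (hU : M.UtilityAssumption) (hc : Measurable c)
    (σ τ : ℝ≥0) :
    M.β * ∫⁻ x, M.crossValue c (M.ret x * σ + M.inc x) (M.ret x * τ + M.inc x) ∂M.shockLaw =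
      M.margVal c σ * τ +
        M.β * ∫⁻ x, M.marg (c (M.ret x * σ + M.inc x)) * M.inc x ∂M.shockLaw := by
  have hr := M.measurable_ret.coe_nnreal_ennreal
  have hy := M.measurable_inc.coe_nnreal_ennreal
  have hv : Measurable fun x => M.marg (c (M.ret x * σ + M.inc x)) :=
    hU.measurable_marg.comp (hc.comp ((M.measurable_ret.mul_const σ).add M.measurable_inc))
  have hexpand (x : Z × E × F) :
      M.crossValue c (M.ret x * σ + M.inc x) (M.ret x * τ + M.inc x) =
        (M.ret x : ℝ≥0∞) * M.marg (c (M.ret x * σ + M.inc x)) * τ +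
          M.marg (c (M.ret x * σ + M.inc x)) * M.inc x := by
    rw [crossValue]
    push_cast
    ring
  have hvy : Measurable fun x => M.marg (c (M.ret x * σ + M.inc x)) * (M.inc x : ℝ≥0∞) := hv.mul hy
  have hrv : Measurable fun x => (M.ret x : ℝ≥0∞) * M.marg (c (M.ret x * σ + M.inc x)) := hr.mul hv
  simp_rw [hexpand]
  rw [lintegral_add_right _ hvy, lintegral_mul_const _ hrv, mul_add, ← mul_assoc]
  rfl

namespace EulerPolicy

lemma margVal_ne_top (hU : M.UtilityAssumption) (hc : M.EulerPolicy c) (σ : ℝ≥0) :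
    M.margVal c σ ≠ ⊤ :=
  ne_top_of_le_ne_top hc.margVal_zero_ne_top (antitone_margVal hU hc.mono zero_le)

lemma lintegral_marg_mul_inc_ne_top (hM : M.StabilityAssumptions) (hc : M.EulerPolicy c)
    (σ : ℝ≥0) : ∫⁻ x, M.marg (c (M.ret x * σ + M.inc x)) * M.inc x ∂M.shockLaw ≠ ⊤ := by
  have hU := hM.utility
  have hy := M.measurable_inc.coe_nnreal_ennreal
  have hm : Measurable fun x => M.marg (M.inc x) := hU.measurable_marg.comp M.measurable_inc
  have hle (x : Z × E × F) : M.marg (c (M.ret x * σ + M.inc x)) * M.inc x ≤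
      M.marg 1 * M.inc x + M.marg (M.inc x) + M.margVal c 0 * M.inc x :=
    calc _ ≤ (M.marg (M.inc x) + M.margVal c 0) * M.inc x := by
          gcongr
          refine (hc.marg_le_add _).trans ?_
          gcongr
          exact hU.marg_antitone le_add_self
      _ ≤ _ := by
          rw [add_mul]
          gcongr
          exact hU.marg_mul_self_le _
  refine ne_top_of_le_ne_top ?_ (lintegral_mono hle)
  rw [lintegral_add_right _ (hy.const_mul _), lintegral_add_right _ hm,
    lintegral_const_mul _ hy, lintegral_const_mul _ hy]
  exact ENNReal.add_ne_top.2 ⟨ENNReal.add_ne_top.2 ⟨ENNReal.mul_ne_top (marg_ne_top one_pos)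
    hM.inc_finite.ne, hM.marg_finite.ne⟩,
    ENNReal.mul_ne_top hc.margVal_zero_ne_top hM.inc_finite.ne⟩

lemma β_mul_lintegral_crossValue_ne_top (hM : M.StabilityAssumptions) (hc : M.EulerPolicy c)
    (σ τ : ℝ≥0) :
    M.β * ∫⁻ x, M.crossValue c (M.ret x * σ + M.inc x) (M.ret x * τ + M.inc x) ∂M.shockLaw
      ≠ ⊤ := by
  rw [hM.utility.β_mul_lintegral_crossValue hc.continuous.measurable]
  exact ENNReal.add_ne_top.2
    ⟨ENNReal.mul_ne_top (hc.margVal_ne_top hM.utility σ) ENNReal.coe_ne_top,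
      ENNReal.mul_ne_top ENNReal.coe_ne_top (hc.lintegral_marg_mul_inc_ne_top hM σ)⟩

-- Complementary slackness: `(u'(c(a)) - G) σ = 0` while `u'(c(a)) ≥ G`.
lemma marg_mul_savings_add_le (hc : M.EulerPolicy c) (a σ' : ℝ≥0) :
    M.marg (c a) * (a - c a : ℝ≥0) + M.margVal c (a - c a) * σ' ≤
      M.margVal c (a - c a) * (a - c a : ℝ≥0) + M.marg (c a) * σ' := by
  rcases eq_zero_or_pos (a - c a) with hσ | hσ
  · have hle : M.margVal c (a - c a) ≤ M.marg (c a) := hc.euler_le a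
    rw [hσ] at hle ⊢
    simp only [ENNReal.coe_zero, mul_zero, zero_add]
    gcongr
  · rw [le_antisymm (hc.euler_ge a hσ) (hc.euler_le a)]

lemma crossValue_step (hM : M.StabilityAssumptions) (hc : M.EulerPolicy c) (hd : Feasible d)
    {p : (ℝ≥0 × Z) × (ℝ≥0 × Z)} {A B δ : ℝ≥0∞}
    (hgap : A + M.marg (c p.1.1) * c p.1.1 + δ ≤ B + M.marg (c p.1.1) * d p.2) :
    A + M.crossValue c p.1.1 p.1.1 + δ +
        M.β * ∫⁻ x, M.crossValue c (M.nextPair c d p x).1.1 (M.nextPair c d p x).2.1 ∂M.shockLaw ≤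
      B + M.crossValue c p.1.1 p.2.1 +
        M.β * ∫⁻ x, M.crossValue c (M.nextPair c d p x).1.1 (M.nextPair c d p x).1.1
          ∂M.shockLaw := by
  obtain ⟨s, s'⟩ := p
  simp only [nextPair, nextState] at hgap ⊢
  rw [hM.utility.β_mul_lintegral_crossValue hc.continuous.measurable,
    hM.utility.β_mul_lintegral_crossValue hc.continuous.measurable]
  set y := M.β * ∫⁻ x, M.marg (c (M.ret x * (s.1 - c s.1) + M.inc x)) * M.inc x ∂M.shockLaw
  have hwealth : (s.1 : ℝ≥0∞) = c s.1 + (s.1 - c s.1 : ℝ≥0) := by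
    exact_mod_cast (add_tsub_cancel_of_le (hc.le s.1)).symm
  have hwealth' : (s'.1 : ℝ≥0∞) = d s' + (s'.1 - d s' : ℝ≥0) := by
    exact_mod_cast (add_tsub_cancel_of_le (hd.le s'.1 s'.2)).symm
  have htotal := add_le_add_left
    (add_le_add hgap (hc.marg_mul_savings_add_le s.1 (s'.1 - d s'))) y
  simp only [crossValue]
  calc _ = _ := ?_
    _ ≤ _ := htotal
    _ = _ := ?_
  · rw [hwealth]
    ring
  · rw [hwealth']
    ring

lemma utilityNeg_le (hU : M.UtilityAssumption) (hc : M.EulerPolicy c) (s : ℝ≥0 × Z) :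
    M.utilityNeg (fun s => c s.1) s ≤
      (ENNReal.ofReal |M.uReal 1| + M.margVal c 0 + 1) * M.growthBound s :=
  calc M.utilityNeg (fun s => c s.1) s ≤ ENNReal.ofReal |M.uReal 1| + M.marg (c s.1) :=
        hU.toENNReal_neg_u_le _
    _ ≤ ENNReal.ofReal |M.uReal 1| + (M.marg s.1 + M.margVal c 0) := by
        gcongr
        exact hc.marg_le_add _
    _ = (ENNReal.ofReal |M.uReal 1| + M.margVal c 0) * 1 + 1 * M.marg s.1 := by ring
    _ ≤ (ENNReal.ofReal |M.uReal 1| + M.margVal c 0) * M.growthBound s +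
          1 * M.growthBound s := by
        gcongr
        · exact one_le_growthBound s
        · exact marg_le_growthBound s
    _ = _ := (add_mul _ _ _).symm

lemma crossValue_self_le (hU : M.UtilityAssumption) (hc : M.EulerPolicy c) (s : ℝ≥0 × Z) :
    M.crossValue c s.1 s.1 ≤ (M.marg 1 + M.margVal c 0 + 1) * M.growthBound s :=
  calc M.crossValue c s.1 s.1 ≤ (M.marg s.1 + M.margVal c 0) * s.1 := by
        unfold crossValue
        gcongr
        exact hc.marg_le_add _
    _ = M.marg s.1 * s.1 + M.margVal c 0 * s.1 := add_mul _ _ _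
    _ ≤ (M.marg 1 * s.1 + M.marg s.1) + M.margVal c 0 * s.1 := by
        gcongr
        exact hU.marg_mul_self_le _
    _ = (M.marg 1 + M.margVal c 0) * s.1 + 1 * M.marg s.1 := by ring
    _ ≤ (M.marg 1 + M.margVal c 0) * M.growthBound s + 1 * M.growthBound s := by
        gcongr
        · exact wealth_le_growthBound s
        · exact marg_le_growthBound s
    _ = _ := (add_mul _ _ _).symm

lemma discountedValue_utilityNeg_ne_top (hM : M.StabilityAssumptions) (hc : M.EulerPolicy c)
    (hs : 0 < s.1) :
    M.discountedValue (fun s => c s.1) (M.utilityNeg fun s => c s.1) s ≠ ⊤ := by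
  have hG := hc.margVal_zero_ne_top
  exact hM.discountedValue_ne_top hc.feasible.measurable hs (by finiteness)
    (hc.utilityNeg_le hM.utility)

lemma discountedValue_crossValue_ne_top (hM : M.StabilityAssumptions) (hc : M.EulerPolicy c)
    (hs : 0 < s.1) :
    M.discountedValue (fun s => c s.1) (fun s => M.crossValue c s.1 s.1) s ≠ ⊤ := by
  have hG := hc.margVal_zero_ne_top
  have hmarg : M.marg 1 ≠ ⊤ := marg_ne_top one_pos
  exact hM.discountedValue_ne_top hc.feasible.measurable hs (by finiteness)
    (hc.crossValue_self_le hM.utility)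

lemma exists_utility_gap (hU : M.UtilityAssumption) (hc : M.EulerPolicy c) (hs : 0 < s.1)
    (d : ℝ≥0 × Z → ℝ≥0) (s' : ℝ≥0 × Z) : ∃ δ : ℝ≥0∞, (d s' ≠ c s.1 → 0 < δ) ∧
      M.utilityPos d s' + M.utilityNeg (fun s => c s.1) s + M.marg (c s.1) * c s.1 + δ ≤
        M.utilityPos (fun s => c s.1) s + M.utilityNeg d s' + M.marg (c s.1) * d s' :=
  hU.exists_concavity_gap (hc.pos hs) (d s')

-- The value of the Euler agent's wealth minus that of the other agent's wealth, both at the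
-- Euler agent's marginal utility, bounds the accumulated difference in utility.
lemma discountedSum_nextPair_add_gap_le (hM : M.StabilityAssumptions) (hc : M.EulerPolicy c)
    (hd : Feasible d) {p : (ℝ≥0 × Z) × (ℝ≥0 × Z)} (hp : 0 < p.1.1) {δ : ℝ≥0∞}
    (hgap : M.utilityPos d p.2 + M.utilityNeg (fun s => c s.1) p.1 +
      M.marg (c p.1.1) * c p.1.1 + δ ≤
        M.utilityPos (fun s => c s.1) p.1 + M.utilityNeg d p.2 + M.marg (c p.1.1) * d p.2) :
    discountedSum (M.nextPair c d) M.shockLaw M.β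
        (fun p => M.utilityPos d p.2 + M.utilityNeg (fun s => c s.1) p.1) p +
          M.crossValue c p.1.1 p.1.1 + δ ≤
      discountedSum (M.nextPair c d) M.shockLaw M.β
        (fun p => M.utilityPos (fun s => c s.1) p.1 + M.utilityNeg d p.2) p +
          M.crossValue c p.1.1 p.2.1 := by
  have hU := hM.utility
  have hcm : Measurable fun s : ℝ≥0 × Z => c s.1 := hc.feasible.measurable
  have hpos_inv (p : (ℝ≥0 × Z) × (ℝ≥0 × Z)) :
      ∀ᵐ x ∂M.shockLaw, M.nextPair c d p x ∈ {p : (ℝ≥0 × Z) × (ℝ≥0 × Z) | 0 < p.1.1} :=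
    hM.inc_pos_ae.mono fun x hx => hx.trans_le le_add_self
  have hsum_ne_top : discountedSum (M.nextPair c d) M.shockLaw M.β
      (fun p => M.crossValue c p.1.1 p.1.1) p ≠ ⊤ := by
    rw [discountedSum_nextPair_fst (fun s => M.crossValue c s.1 s.1)]
    exact hc.discountedValue_crossValue_ne_top hM hp
  refine discountedSum_add_le_of_step (f := M.nextPair c d) (β := M.β) (δ := δ)
    (A := fun p => M.utilityPos d p.2 + M.utilityNeg (fun s => c s.1) p.1)
    (B := fun p => M.utilityPos (fun s => c s.1) p.1 + M.utilityNeg d p.2)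
    (U := fun p => M.crossValue c p.1.1 p.2.1)
    (V := fun p => M.crossValue c p.1.1 p.1.1) (D := {p | 0 < p.1.1})
    (measurable_nextPair hc.continuous.measurable hd.measurable) ?_ ?_ ?_
    (fun p _ => hpos_inv p) (fun p _ => hc.β_mul_lintegral_crossValue_ne_top hM _ _)
    (fun p _ => hc.β_mul_lintegral_crossValue_ne_top hM _ _) (fun p hp => ?_)
    hp hsum_ne_top (hc.crossValue_step hM hd hgap)
  · exact ((hU.measurable_utilityPos hd.measurable).comp measurable_snd).add
      ((hU.measurable_utilityNeg hcm).comp measurable_fst)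
  · exact ((hU.measurable_utilityPos hcm).comp measurable_fst).add
      ((hU.measurable_utilityNeg hd.measurable).comp measurable_snd)
  · exact (hU.measurable_crossValue_self hc.continuous.measurable).comp
      (measurable_fst.comp measurable_fst)
  · obtain ⟨δ', -, hgap'⟩ := hc.exists_utility_gap hU hp d p.2
    simpa only [add_zero] using hc.crossValue_step hM hd (δ := 0)
      ((add_zero _).trans_le (le_self_add.trans hgap'))

theorem discountedValue_add_gap_le (hM : M.StabilityAssumptions) (hc : M.EulerPolicy c)
    (hd : Feasible d) (hs : 0 < s.1) {δ : ℝ≥0∞}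
    (hgap : M.utilityPos d s + M.utilityNeg (fun s => c s.1) s + M.marg (c s.1) * c s.1 + δ ≤
      M.utilityPos (fun s => c s.1) s + M.utilityNeg d s + M.marg (c s.1) * d s) :
    M.discountedValue d (M.utilityPos d) s +
        M.discountedValue (fun s => c s.1) (M.utilityNeg fun s => c s.1) s + δ ≤
      M.discountedValue (fun s => c s.1) (M.utilityPos fun s => c s.1) s +
        M.discountedValue d (M.utilityNeg d) s := by
  have hf := measurable_nextPair (M := M) hc.continuous.measurable hd.measurable
  have hposd : Measurable fun p : (ℝ≥0 × Z) × (ℝ≥0 × Z) => M.utilityPos d p.2 :=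
    (hM.utility.measurable_utilityPos hd.measurable).comp measurable_snd
  have hposc : Measurable fun p : (ℝ≥0 × Z) × (ℝ≥0 × Z) => M.utilityPos (fun s => c s.1) p.1 :=
    (hM.utility.measurable_utilityPos hc.feasible.measurable).comp measurable_fst
  have hpair := hc.discountedSum_nextPair_add_gap_le hM hd (p := (s, s)) hs hgap
  rw [discountedSum_add hf hposd, discountedSum_add hf hposc, discountedSum_nextPair_fst,
    discountedSum_nextPair_fst, discountedSum_nextPair_snd, discountedSum_nextPair_snd,
    add_right_comm] at hpair
  exact (ENNReal.add_le_add_iff_right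
    (ENNReal.mul_ne_top (marg_ne_top (hc.pos hs)) ENNReal.coe_ne_top)).1 hpair

theorem lifetimeValue_le (hM : M.StabilityAssumptions) (hc : M.EulerPolicy c) (hd : Feasible d)
    (hs : 0 < s.1) : M.lifetimeValue d s ≤ M.lifetimeValue (fun s => c s.1) s := by
  obtain ⟨δ, -, hgap⟩ := hc.exists_utility_gap hM.utility hs d s
  rw [lifetimeValue_eq hM.utility hd.measurable, lifetimeValue_eq hM.utility hc.feasible.measurable]
  exact coe_sub_coe_le_coe_sub_coe (hc.discountedValue_utilityNeg_ne_top hM hs)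
    (le_self_add.trans (hc.discountedValue_add_gap_le hM hd hs hgap))

theorem lifetimeValue_lt (hM : M.StabilityAssumptions) (hc : M.EulerPolicy c) (hd : Feasible d)
    (hs : 0 < s.1) (hdc : d s ≠ c s.1) :
    M.lifetimeValue d s < M.lifetimeValue (fun s => c s.1) s := by
  obtain ⟨δ, hδ, hgap⟩ := hc.exists_utility_gap hM.utility hs d s
  have hneg_ne_top := hc.discountedValue_utilityNeg_ne_top hM hs
  have hsum_ne_top := ENNReal.add_ne_top.2
    ⟨hM.discountedValue_utilityPos_ne_top hd hs, hneg_ne_top⟩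
  rw [lifetimeValue_eq hM.utility hd.measurable, lifetimeValue_eq hM.utility hc.feasible.measurable]
  exact coe_sub_coe_lt_coe_sub_coe hneg_ne_top ((ENNReal.lt_add_right hsum_ne_top
    (hδ hdc).ne').trans_le (hc.discountedValue_add_gap_le hM hd hs hgap))

theorem isOptimal (hM : M.StabilityAssumptions) (hc : M.EulerPolicy c) :
    M.IsOptimal fun s => c s.1 :=
  ⟨hc.feasible, fun _ hd _ _ ha => hc.lifetimeValue_le hM hd ha⟩

theorem eq_of_isOptimal (hM : M.StabilityAssumptions) (hc : M.EulerPolicy c)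
    (hd : M.IsOptimal d) : d = fun s => c s.1 := by
  funext ⟨a, z⟩
  rcases eq_zero_or_pos a with rfl | ha
  · exact (le_antisymm (hd.1.le 0 z) zero_le).trans (le_antisymm (hc.le 0) zero_le).symm
  · by_contra hne
    exact (hc.lifetimeValue_lt hM hd.1 (s := (a, z)) ha hne).not_ge (hd.2 _ hc.feasible a z ha)

end EulerPolicy

end IncomeFluctuation

/-! ### Recurrence of random iterations -/

section Recurrence

variable {X S : Type*} {f : X → S → X} {G A : Set X}

/-- The shock sequences along which the path from `a` lies in `G` at all times `t < n`. -/
def staySet (f : X → S → X) (G : Set X) (n : ℕ) (a : X) : Set (ℕ → S) :=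
  {w | ∀ t < n, iterPath f a w t ∈ G}

lemma antitone_staySet (a : X) : Antitone fun n => staySet f G n a :=
  fun _ _ hmn _ hw t ht => hw t (ht.trans_le hmn)

lemma seqCons_mem_staySet_succ {n : ℕ} {a : X} {x : S} {w : ℕ → S} :
    seqCons x w ∈ staySet f G (n + 1) a ↔ a ∈ G ∧ w ∈ staySet f G n (f a x) := by
  simp only [staySet, Set.mem_ofPred_eq, Nat.forall_lt_succ_left, iterPath_succ', seqCons_zero,
    seqShift_seqCons]
  rfl

lemma iterPath_mono [Preorder X] (hmono : ∀ x, Monotone fun a => f a x) {a b : X} (hab : a ≤ b)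
    (w : ℕ → S) (t : ℕ) : iterPath f a w t ≤ iterPath f b w t := by
  induction t with
  | zero => exact hab
  | succ t ih => exact hmono _ ih

lemma iterPath_eq_of_le {a b : X} {w : ℕ → S} {s t : ℕ}
    (hs : iterPath f a w s = iterPath f b w s) (hst : s ≤ t) :
    iterPath f a w t = iterPath f b w t := by
  induction t, hst using Nat.le_induction with
  | base => exact hs
  | succ t _ ih => rw [iterPath, iterPath, ih]

variable [MeasurableSpace S] {ν : Measure S} [IsProbabilityMeasure ν]

theorem coalescing_of_ae_exists_notMem [SemilatticeSup X] (hmono : ∀ x, Monotone fun a => f a x)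
    (hG : IsUpperSet G) (hconst : ∀ a ∉ G, ∀ b ∉ G, f a = f b)
    (hleave : ∀ a, ∀ᵐ w ∂Measure.infinitePi (fun _ : ℕ => ν), ∃ t, iterPath f a w t ∉ G) :
    Coalescing f ν := by
  intro a b
  filter_upwards [hleave (a ⊔ b)] with w ⟨t, ht⟩
  have hout {e : X} (he : e ≤ a ⊔ b) : iterPath f e w t ∉ G :=
    fun hmem => ht (hG (iterPath_mono hmono he w t) hmem)
  have hmeet : iterPath f a w (t + 1) = iterPath f b w (t + 1) :=
    congrFun (hconst _ (hout le_sup_left) _ (hout le_sup_right)) (w t)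
  filter_upwards [eventually_ge_atTop (t + 1)] with n hn
  exact iterPath_eq_of_le hmeet hn

variable [MeasurableSpace X]

lemma measurableSet_staySet (hf : Measurable fun p : X × S => f p.1 p.2) (hG : MeasurableSet G)
    (n : ℕ) (a : X) : MeasurableSet (staySet f G n a) := by
  have hInter : staySet f G n a = ⋂ t < n, (fun w => iterPath f a w t) ⁻¹' G := by
    ext w
    simp [staySet]
  rw [hInter]
  exact .iInter fun t => .iInter fun _ => measurable_iterPath_right hf a t hG

lemma tendsto_measure_staySet (hf : Measurable fun p : X × S => f p.1 p.2) (hG : MeasurableSet G)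
    (a : X) :
    Tendsto (fun n => Measure.infinitePi (fun _ : ℕ => ν) (staySet f G n a)) atTop
      (𝓝 (Measure.infinitePi (fun _ : ℕ => ν) (⋂ n, staySet f G n a))) :=
  tendsto_measure_iInter_atTop (fun n => (measurableSet_staySet hf hG n a).nullMeasurableSet)
    (antitone_staySet a) ⟨0, measure_ne_top _ _⟩

lemma measure_staySet_add_inter_le (hf : Measurable fun p : X × S => f p.1 p.2)
    (hG : MeasurableSet G) (hA : MeasurableSet A) {T : ℕ} {θ : ℝ≥0∞} (hθ_top : θ ≠ ⊤)
    (hθ : ∀ a ∈ A, Measure.infinitePi (fun _ : ℕ => ν) (staySet f G T a) ≤ θ) (n : ℕ) (a : X) :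
    Measure.infinitePi (fun _ : ℕ => ν) (staySet f G (n + T) a ∩ {w | iterPath f a w n ∈ A}) ≤
      θ * Measure.infinitePi (fun _ : ℕ => ν) (staySet f G n a ∩ {w | iterPath f a w n ∈ A}) := by
  have hmeas (k n : ℕ) (a : X) :
      MeasurableSet (staySet f G k a ∩ {w | iterPath f a w n ∈ A}) :=
    (measurableSet_staySet hf hG k a).inter (measurable_iterPath_right hf a n hA)
  have hcons (k n : ℕ) (a : X) (x : S) :
      seqCons x ⁻¹' (staySet f G (k + 1) a ∩ {w | iterPath f a w (n + 1) ∈ A}) =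
        {w | a ∈ G ∧ w ∈ staySet f G k (f a x) ∩ {w | iterPath f (f a x) w n ∈ A}} := by
    ext w
    simp only [Set.mem_preimage, Set.mem_ofPred_eq, Set.mem_inter_iff, seqCons_mem_staySet_succ,
      iterPath_succ', seqCons_zero, seqShift_seqCons, and_assoc]
  induction n generalizing a with
  | zero =>
    by_cases ha : a ∈ A
    · have huniv : staySet f G 0 a ∩ {w | iterPath f a w 0 ∈ A} = Set.univ := by
        ext w
        simpa [staySet, iterPath] using ha
      rw [huniv, measure_univ, mul_one, zero_add]
      exact (measure_mono Set.inter_subset_left).trans (hθ a ha)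
    · simp [iterPath, ha]
  | succ n ih =>
    rw [Nat.add_right_comm, measure_infinitePi_eq_seqCons ν (hmeas _ _ _),
      measure_infinitePi_eq_seqCons ν (hmeas _ _ _)]
    simp only [hcons]
    by_cases ha : a ∈ G
    · simp only [ha, true_and, Set.ofPred_mem_eq]
      exact (lintegral_mono fun x => ih (f a x)).trans_eq (lintegral_const_mul' _ _ hθ_top)
    · simp [ha]

/-- Each visit to `A` loses a fraction `1 - θ` of the mass of the paths still in `G`, and the total
loss is finite. -/
lemma tendsto_measure_staySet_inter_zero (hf : Measurable fun p : X × S => f p.1 p.2)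
    (hG : MeasurableSet G) (hA : MeasurableSet A) {T : ℕ} {θ : ℝ≥0∞} (hθ_lt : θ < 1)
    (hθ : ∀ a ∈ A, Measure.infinitePi (fun _ : ℕ => ν) (staySet f G T a) ≤ θ) (a : X) :
    Tendsto (fun n => Measure.infinitePi (fun _ : ℕ => ν)
      (staySet f G n a ∩ {w | iterPath f a w n ∈ A})) atTop (𝓝 0) := by
  set P := Measure.infinitePi fun _ : ℕ => ν
  set p : ℕ → ℝ≥0∞ := fun n => P (staySet f G n a)
  set q : ℕ → ℝ≥0∞ := fun n => P (staySet f G n a ∩ {w | iterPath f a w n ∈ A})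
  have hlim : Tendsto p atTop (𝓝 (P (⋂ n, staySet f G n a))) := tendsto_measure_staySet hf hG a
  have hloss (n : ℕ) : p (n + T) + (1 - θ) * q n ≤ p n := by
    have hvisit : MeasurableSet {w | iterPath f a w n ∈ A} := measurable_iterPath_right hf a n hA
    calc p (n + T) + (1 - θ) * q n
        = P (staySet f G (n + T) a ∩ {w | iterPath f a w n ∈ A}) +
            P (staySet f G (n + T) a \ {w | iterPath f a w n ∈ A}) + (1 - θ) * q n := by
          rw [measure_inter_add_sdiff _ hvisit]
      _ ≤ θ * q n + P (staySet f G n a \ {w | iterPath f a w n ∈ A}) + (1 - θ) * q n := by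
          gcongr
          · exact measure_staySet_add_inter_le hf hG hA hθ_lt.ne_top hθ n a
          · exact antitone_staySet a (Nat.le_add_right n T)
      _ = (θ + (1 - θ)) * q n + P (staySet f G n a \ {w | iterPath f a w n ∈ A}) := by ring
      _ = p n := by rw [add_tsub_cancel_of_le hθ_lt.le, one_mul, measure_inter_add_sdiff _ hvisit]
  have hbound (n : ℕ) : q n ≤ (1 - θ)⁻¹ * (p n - p (n + T)) := by
    rw [mul_comm, ← div_eq_mul_inv, ENNReal.le_div_iff_mul_le
      (.inl (tsub_pos_of_lt hθ_lt).ne') (.inl (by finiteness)), mul_comm]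
    exact ENNReal.le_sub_of_add_le_left (measure_ne_top _ _) (hloss n)
  have hzero : Tendsto (fun n => (1 - θ)⁻¹ * (p n - p (n + T))) atTop (𝓝 0) := by
    have := ENNReal.Tendsto.const_mul (a := (1 - θ)⁻¹)
      (ENNReal.Tendsto.sub hlim ((tendsto_add_atTop_iff_nat T).2 hlim)
        (.inl (measure_ne_top _ _)))
      (.inr (ENNReal.inv_ne_top.2 (tsub_pos_of_lt hθ_lt).ne'))
    simpa only [tsub_self, mul_zero] using this
  exact tendsto_of_tendsto_of_tendsto_of_le_of_le tendsto_const_nhds hzero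
    (fun _ => zero_le) hbound

lemma measure_iInter_staySet_le_div (hf : Measurable fun p : X × S => f p.1 p.2)
    (hG : MeasurableSet G) {V : X → ℝ≥0∞} (hV : Measurable V) {a : X} {C : ℝ≥0∞}
    (hmean : ∀ n, ∫⁻ w, V (iterPath f a w n) ∂Measure.infinitePi (fun _ : ℕ => ν) ≤ C)
    {r : ℝ≥0∞} (hr : r ≠ 0) (hr_top : r ≠ ⊤) {T : ℕ} {θ : ℝ≥0∞} (hθ_lt : θ < 1)
    (hθ : ∀ b, V b ≤ r → Measure.infinitePi (fun _ : ℕ => ν) (staySet f G T b) ≤ θ) :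
    Measure.infinitePi (fun _ : ℕ => ν) (⋂ n, staySet f G n a) ≤ C / r := by
  set P := Measure.infinitePi fun _ : ℕ => ν
  have hAm : MeasurableSet {b | V b ≤ r} := hV measurableSet_Iic
  have hlim := (tendsto_measure_staySet_inter_zero hf hG hAm hθ_lt hθ a).add_const (C / r)
  rw [zero_add] at hlim
  refine ge_of_tendsto' hlim fun n => ?_
  have hlarge : P {w | iterPath f a w n ∈ {b | V b ≤ r}}ᶜ ≤ C / r :=
    calc P {w | iterPath f a w n ∈ {b | V b ≤ r}}ᶜ
        ≤ P {w | r ≤ V (iterPath f a w n)} :=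
          measure_mono fun _ hw => show r ≤ _ from le_of_not_ge fun hle => hw hle
      _ ≤ (∫⁻ w, V (iterPath f a w n) ∂P) / r := meas_ge_le_lintegral_div
          (hV.comp (measurable_iterPath_right hf a n)).aemeasurable hr hr_top
      _ ≤ C / r := by gcongr; exact hmean n
  calc P (⋂ n, staySet f G n a) ≤ P (staySet f G n a) := measure_mono (Set.iInter_subset _ n)
    _ ≤ _ := measure_le_inter_add_sdiff _ _ _
    _ ≤ _ := by
        gcongr
        exact (measure_mono fun w hw => hw.2).trans hlarge

theorem ae_exists_iterPath_notMem (hf : Measurable fun p : X × S => f p.1 p.2)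
    (hG : MeasurableSet G) {V : X → ℝ≥0∞} (hV : Measurable V) {a : X} {C : ℝ≥0∞} (hC : C ≠ ⊤)
    (hmean : ∀ n, ∫⁻ w, V (iterPath f a w n) ∂Measure.infinitePi (fun _ : ℕ => ν) ≤ C)
    (hexit : ∀ r : ℝ≥0, ∃ T, ∃ θ < (1 : ℝ≥0∞), ∀ b, V b ≤ r →
      Measure.infinitePi (fun _ : ℕ => ν) (staySet f G T b) ≤ θ) :
    ∀ᵐ w ∂Measure.infinitePi (fun _ : ℕ => ν), ∃ t, iterPath f a w t ∉ G := by
  have hle (n : ℕ) :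
      Measure.infinitePi (fun _ : ℕ => ν) (⋂ n, staySet f G n a) ≤ C / ((n + 1 : ℕ) : ℝ≥0∞) := by
    obtain ⟨T, θ, hθ_lt, hθ⟩ := hexit (n + 1 : ℕ)
    exact measure_iInter_staySet_le_div hf hG hV hmean (Nat.cast_ne_zero.2 n.succ_ne_zero)
      (ENNReal.natCast_ne_top _) hθ_lt (by simpa using hθ)
  have hlim : Tendsto (fun n : ℕ => C / ((n + 1 : ℕ) : ℝ≥0∞)) atTop (𝓝 0) := by
    have := ENNReal.Tendsto.const_mul ENNReal.tendsto_inv_nat_nhds_zero (.inr hC)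
    rw [mul_zero] at this
    simpa only [div_eq_mul_inv] using (tendsto_add_atTop_iff_nat 1).2 this
  have hnull := le_antisymm (ge_of_tendsto' hlim hle) zero_le
  filter_upwards [measure_eq_zero_iff_ae_notMem.1 hnull] with w hw
  by_contra! hstay
  exact hw (Set.mem_iInter.2 fun _ t _ => hstay t)

end Recurrence

/-! ### Random iterations with a contracting drift -/

section Drift

variable {X S : Type*}

/-- The `n`-th backward iterate: the shocks `w 0, …, w (n - 1)` act on `a`, and `w 0` acts last. -/
def backIter (f : X → S → X) (a : X) : ℕ → (ℕ → S) → X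
  | 0, _ => a
  | n + 1, w => f (backIter f a n (seqShift w)) (w 0)

variable [MeasurableSpace X] [MeasurableSpace S] {f : X → S → X} {ν : Measure S}
  [IsProbabilityMeasure ν] {V : X → ℝ≥0∞} {ρ κ : ℝ≥0∞}

lemma lintegral_iterPath_le_sum (hf : Measurable fun p : X × S => f p.1 p.2) (hV : Measurable V)
    (hdrift : ∀ a, ∫⁻ x, V (f a x) ∂ν ≤ ρ * V a + κ) (n : ℕ) (a : X) :
    ∫⁻ w, V (iterPath f a w n) ∂Measure.infinitePi (fun _ : ℕ => ν) ≤
      ρ ^ n * V a + κ * ∑ k ∈ Finset.range n, ρ ^ k := by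
  induction n generalizing a with
  | zero => simp [iterPath]
  | succ n ih =>
    have hstep : Measurable fun x => V (f a x) := hV.comp (hf.comp measurable_prodMk_left)
    have hpath : Measurable fun w => V (iterPath f a w (n + 1)) :=
      hV.comp (measurable_iterPath_right hf a (n + 1))
    rw [lintegral_infinitePi_eq_seqCons ν hpath]
    simp only [iterPath_succ', seqCons_zero, seqShift_seqCons]
    calc _ ≤ ∫⁻ x, (ρ ^ n * V (f a x) + κ * ∑ k ∈ Finset.range n, ρ ^ k) ∂ν :=
          lintegral_mono fun x => ih _
      _ = ρ ^ n * ∫⁻ x, V (f a x) ∂ν + κ * ∑ k ∈ Finset.range n, ρ ^ k := by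
          rw [lintegral_add_right _ measurable_const, lintegral_const_mul _ hstep, lintegral_const,
            measure_univ, mul_one]
      _ ≤ ρ ^ n * (ρ * V a + κ) + κ * ∑ k ∈ Finset.range n, ρ ^ k := by
          gcongr
          exact hdrift a
      _ = _ := by rw [Finset.sum_range_succ, pow_succ]; ring

lemma lintegral_iterPath_le (hf : Measurable fun p : X × S => f p.1 p.2) (hV : Measurable V)
    (hdrift : ∀ a, ∫⁻ x, V (f a x) ∂ν ≤ ρ * V a + κ) (hρ : ρ ≤ 1) (n : ℕ) (a : X) :
    ∫⁻ w, V (iterPath f a w n) ∂Measure.infinitePi (fun _ : ℕ => ν) ≤ V a + κ / (1 - ρ) :=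
  calc _ ≤ ρ ^ n * V a + κ * ∑ k ∈ Finset.range n, ρ ^ k :=
        lintegral_iterPath_le_sum hf hV hdrift n a
    _ ≤ 1 * V a + κ * ∑' k, ρ ^ k := by
        gcongr
        · exact pow_le_one₀ zero_le hρ
        · exact ENNReal.sum_le_tsum _
    _ = _ := by rw [one_mul, ENNReal.tsum_geometric, div_eq_mul_inv]

lemma measurable_backIter (hf : Measurable fun p : X × S => f p.1 p.2) (a : X) (n : ℕ) :
    Measurable (backIter f a n) := by
  induction n with
  | zero => exact measurable_const
  | succ n ih => exact hf.comp ((ih.comp measurable_seqShift).prodMk (measurable_pi_apply 0))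

lemma lintegral_backIter_le (hf : Measurable fun p : X × S => f p.1 p.2) (hV : Measurable V)
    (hdrift : ∀ a, ∫⁻ x, V (f a x) ∂ν ≤ ρ * V a + κ) (hρ : ρ < 1) {a : X}
    (ha : V a ≤ κ / (1 - ρ)) (n : ℕ) :
    ∫⁻ w, V (backIter f a n w) ∂Measure.infinitePi (fun _ : ℕ => ν) ≤ κ / (1 - ρ) := by
  set P := Measure.infinitePi fun _ : ℕ => ν
  have hVb (n : ℕ) : Measurable fun w => V (backIter f a n w) :=
    hV.comp (measurable_backIter hf a n)
  induction n with
  | zero => simpa [backIter] using ha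
  | succ n ih =>
    have hjoint : Measurable fun p : S × (ℕ → S) => V (f (backIter f a n p.2) p.1) :=
      hV.comp (hf.comp (((measurable_backIter hf a n).comp measurable_snd).prodMk measurable_fst))
    calc ∫⁻ w, V (backIter f a (n + 1) w) ∂P
        = ∫⁻ x, ∫⁻ w, V (f (backIter f a n w) x) ∂P ∂ν :=
          lintegral_infinitePi_eq_seqCons ν (hVb (n + 1))
      _ = ∫⁻ w, ∫⁻ x, V (f (backIter f a n w) x) ∂ν ∂P :=
          lintegral_lintegral_swap hjoint.aemeasurable
      _ ≤ ∫⁻ w, (ρ * V (backIter f a n w) + κ) ∂P := lintegral_mono fun w => hdrift _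
      _ = ρ * ∫⁻ w, V (backIter f a n w) ∂P + κ := by
          rw [lintegral_add_right _ measurable_const, lintegral_const_mul _ (hVb n),
            lintegral_const, measure_univ, mul_one]
      _ ≤ ρ * (κ / (1 - ρ)) + κ := by gcongr
      _ = κ / (1 - ρ) := by rw [add_comm, ennreal_add_mul_div_one_sub hρ]

lemma map_prod_eq_of_ae_eq_seqShift (hf : Measurable fun p : X × S => f p.1 p.2)
    {Φ : (ℕ → S) → X} (hΦ : Measurable Φ)
    (hfix : ∀ᵐ w ∂Measure.infinitePi (fun _ : ℕ => ν), Φ w = f (Φ (seqShift w)) (w 0)) :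
    (((Measure.infinitePi fun _ : ℕ => ν).map Φ).prod ν).map (fun p => f p.1 p.2) =
      (Measure.infinitePi fun _ : ℕ => ν).map Φ := by
  set P := Measure.infinitePi fun _ : ℕ => ν
  have hsplit : MeasurePreserving (fun q : (ℕ → S) × S => seqCons q.2 q.1) (P.prod ν) P :=
    (measurePreserving_seqCons ν).comp Measure.measurePreserving_swap
  have hΦ_prod : MeasurePreserving (Prod.map Φ (id : S → S)) (P.prod ν) ((P.map Φ).prod ν) :=
    (hΦ.measurePreserving P).prod (MeasurePreserving.id ν)
  have hstep : Measurable fun w : ℕ → S => f (Φ (seqShift w)) (w 0) :=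
    hf.comp ((hΦ.comp measurable_seqShift).prodMk (measurable_pi_apply 0))
  calc ((P.map Φ).prod ν).map (fun p => f p.1 p.2)
      = (P.prod ν).map (fun q => f (Φ q.1) q.2) := by
        rw [← hΦ_prod.map_eq, Measure.map_map hf hΦ_prod.measurable]
        rfl
    _ = P.map fun w => f (Φ (seqShift w)) (w 0) := by
        conv_rhs => rw [← hsplit.map_eq, Measure.map_map hstep hsplit.measurable]
        rfl
    _ = P.map Φ := (Measure.map_congr hfix).symm

end Drift

section MonotoneDrift

variable {S : Type*} {f : ℝ≥0 → S → ℝ≥0}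

lemma monotone_backIter_zero (hmono : ∀ x, Monotone fun a => f a x) (w : ℕ → S) :
    Monotone fun n => backIter f 0 n w := by
  refine monotone_nat_of_le_succ fun n => ?_
  induction n generalizing w with
  | zero => exact zero_le
  | succ n ih => exact hmono _ (ih _)

variable [MeasurableSpace S] {ν : Measure S} [IsProbabilityMeasure ν] {ρ κ : ℝ≥0∞}

lemma ae_bddAbove_backIter_zero (hf : Measurable fun p : ℝ≥0 × S => f p.1 p.2)
    (hmono : ∀ x, Monotone fun a => f a x)
    (hdrift : ∀ a, ∫⁻ x, (f a x : ℝ≥0∞) ∂ν ≤ ρ * a + κ) (hρ : ρ < 1) (hκ : κ ≠ ⊤) :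
    ∀ᵐ w ∂Measure.infinitePi (fun _ : ℕ => ν), BddAbove (Set.range fun n => backIter f 0 n w) := by
  have hmeas (n : ℕ) : Measurable fun w => ((backIter f 0 n w : ℝ≥0) : ℝ≥0∞) :=
    (measurable_backIter hf 0 n).coe_nnreal_ennreal
  have hsup : ∫⁻ w, ⨆ n, ((backIter f 0 n w : ℝ≥0) : ℝ≥0∞) ∂Measure.infinitePi (fun _ : ℕ => ν) ≤
      κ / (1 - ρ) := by
    rw [lintegral_iSup hmeas fun _ _ hmn w =>
      ENNReal.coe_le_coe.2 (monotone_backIter_zero hmono w hmn)]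
    exact iSup_le (lintegral_backIter_le hf measurable_coe_nnreal_ennreal hdrift hρ (by simp))
  have hfin : κ / (1 - ρ) ≠ ⊤ := ENNReal.div_ne_top hκ (tsub_pos_of_lt hρ).ne'
  filter_upwards [ae_lt_top (.iSup hmeas) (ne_top_of_le_ne_top hfin hsup)] with w hw
  exact ENNReal.iSup_coe_lt_top.1 hw

/-- The limit of the increasing backward iterates from `0` has the stationary law. -/
theorem exists_stationary_of_monotone_of_drift (hf : Measurable fun p : ℝ≥0 × S => f p.1 p.2)
    (hmono : ∀ x, Monotone fun a => f a x) (hcont : ∀ x, Continuous fun a => f a x)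
    (hdrift : ∀ a, ∫⁻ x, (f a x : ℝ≥0∞) ∂ν ≤ ρ * a + κ) (hρ : ρ < 1) (hκ : κ ≠ ⊤) :
    ∃ ψ : Measure ℝ≥0, IsProbabilityMeasure ψ ∧ (ψ.prod ν).map (fun p => f p.1 p.2) = ψ := by
  set Φ : (ℕ → S) → ℝ≥0 := fun w => ⨆ n, backIter f 0 n w
  have hΦ : Measurable Φ := .iSup (measurable_backIter hf 0)
  have hbdd := ae_bddAbove_backIter_zero hf hmono hdrift hρ hκ
  have hlim {w : ℕ → S} (hw : BddAbove (Set.range fun n => backIter f 0 n w)) :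
      Tendsto (fun n => backIter f 0 n w) atTop (𝓝 (Φ w)) :=
    tendsto_atTop_ciSup (monotone_backIter_zero hmono w) hw
  refine ⟨_, Measure.isProbabilityMeasure_map hΦ.aemeasurable,
    map_prod_eq_of_ae_eq_seqShift hf hΦ ?_⟩
  filter_upwards [hbdd, (measurePreserving_seqShift ν).quasiMeasurePreserving.ae hbdd]
    with w hw hw_shift
  exact tendsto_nhds_unique ((tendsto_add_atTop_iff_nat 1).2 (hlim hw))
    (((hcont (w 0)).tendsto _).comp (hlim hw_shift))

end MonotoneDrift

/-! ### Wealth under an Euler policy -/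

namespace IncomeFluctuation

variable {m : ℕ} {Z : Set (EuclideanSpace ℝ (Fin m))} {E F : Type*}
  [MeasurableSpace E] [MeasurableSpace F] {M : IncomeFluctuation Z E F} {c : ℝ≥0 → ℝ≥0}

instance : IsProbabilityMeasure M.seqLaw := by unfold seqLaw; infer_instance

namespace EulerPolicy

lemma measurable_nextAsset (hc : M.EulerPolicy c) :
    Measurable fun p : ℝ≥0 × (Z × E × F) => M.nextAsset c p.1 p.2 :=
  M.measurable_nextAsset hc.continuous.measurable

lemma monotone_nextAsset (hc : M.EulerPolicy c) (x : Z × E × F) :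
    Monotone fun a => M.nextAsset c a x :=
  fun _ _ hab => add_le_add_left (mul_le_mul_right (hc.savings_mono hab) (M.ret x)) (M.inc x)

lemma continuous_nextAsset (hc : M.EulerPolicy c) (x : Z × E × F) :
    Continuous fun a => M.nextAsset c a x :=
  (continuous_const.mul (continuous_id.sub hc.continuous)).add continuous_const

lemma measurableSet_savings_pos (hc : M.EulerPolicy c) : MeasurableSet {a | 0 < a - c a} :=
  measurableSet_lt measurable_const (measurable_id.sub hc.continuous.measurable)

lemma exists_lintegral_nextAsset_le (hc : M.EulerPolicy c) :
    ∃ ρ < (1 : ℝ≥0∞), ∀ a, ∫⁻ x, (M.nextAsset c a x : ℝ≥0∞) ∂M.shockLaw ≤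
      ρ * a + ∫⁻ x, (M.inc x : ℝ≥0∞) ∂M.shockLaw := by
  obtain ⟨α, -, hρ, hα⟩ := hc.rate
  refine ⟨_, hρ, fun a => ?_⟩
  have hsavings : a - c a ≤ (1 - α) * a := by
    rw [tsub_mul, one_mul]
    exact tsub_le_tsub_left (hα a) a
  calc ∫⁻ x, (M.nextAsset c a x : ℝ≥0∞) ∂M.shockLaw
      ≤ ∫⁻ x, ((M.ret x : ℝ≥0∞) * ((1 - α : ℝ≥0) * a) + M.inc x) ∂M.shockLaw := by
        refine lintegral_mono fun x => ?_
        simp only [nextAsset]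
        norm_cast
        gcongr
    _ = _ := by
        rw [lintegral_add_right _ M.measurable_inc.coe_nnreal_ennreal,
          lintegral_mul_const _ M.measurable_ret.coe_nnreal_ennreal]
        ring

/-- While savings are positive the Euler equation holds with equality, so it can be iterated. -/
lemma marg_le_pow_mul_of_ae_mem_staySet (hU : M.UtilityAssumption) (hc : M.EulerPolicy c) (n : ℕ)
    (a : ℝ≥0)
    (hstay : ∀ᵐ w ∂M.seqLaw, w ∈ staySet (M.nextAsset c) {a | 0 < a - c a} (n + 1) a) :
    M.marg (c a) ≤ (M.β * ∫⁻ x, (M.ret x : ℝ≥0∞) ∂M.shockLaw) ^ n * M.margVal c 0 := by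
  set δ := M.β * ∫⁻ x, (M.ret x : ℝ≥0∞) ∂M.shockLaw
  have heuler : M.marg (c a) ≤ M.margVal c (a - c a) := by
    obtain ⟨_, hw⟩ := hstay.exists
    exact hc.euler_ge a (hw 0 n.succ_pos)
  induction n generalizing a with
  | zero =>
    rw [pow_zero, one_mul]
    exact heuler.trans (antitone_margVal hU hc.mono zero_le)
  | succ n ih =>
    have hstay_next : ∀ᵐ x ∂M.shockLaw, ∀ᵐ w ∂M.seqLaw,
        seqCons x w ∈ staySet (M.nextAsset c) {a | 0 < a - c a} (n + 1 + 1) a :=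
      (ae_infinitePi_iff_ae_seqCons M.shockLaw (measurableSet_staySet
        hc.measurable_nextAsset hc.measurableSet_savings_pos _ _)).1 hstay
    have hmarg_next : ∀ᵐ x ∂M.shockLaw,
        M.marg (c (M.nextAsset c a x)) ≤ δ ^ n * M.margVal c 0 := by
      filter_upwards [hstay_next] with x hx
      have hstay_x : ∀ᵐ w ∂M.seqLaw,
          w ∈ staySet (M.nextAsset c) {a | 0 < a - c a} (n + 1) (M.nextAsset c a x) :=
        hx.mono fun w hw => (seqCons_mem_staySet_succ.1 hw).2
      obtain ⟨_, hw⟩ := hstay_x.exists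
      exact ih _ hstay_x (hc.euler_ge _ (hw 0 n.succ_pos))
    calc M.marg (c a) ≤ M.margVal c (a - c a) := heuler
      _ ≤ M.β * ∫⁻ x, (M.ret x : ℝ≥0∞) * (δ ^ n * M.margVal c 0) ∂M.shockLaw := by
          rw [margVal]
          gcongr 1
          refine lintegral_mono_ae (hmarg_next.mono fun x hx => ?_)
          gcongr
          exact hx
      _ = δ ^ (n + 1) * M.margVal c 0 := by
          rw [lintegral_mul_const _ M.measurable_ret.coe_nnreal_ennreal, pow_succ]
          ring

lemma exists_measure_staySet_lt_one (hM : M.StabilityAssumptions) (hc : M.EulerPolicy c)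
    (a : ℝ≥0) : ∃ T, M.seqLaw (staySet (M.nextAsset c) {a | 0 < a - c a} T a) < 1 := by
  have hlim : Tendsto (fun n => (M.β * ∫⁻ x, (M.ret x : ℝ≥0∞) ∂M.shockLaw) ^ n * M.margVal c 0)
      atTop (𝓝 0) := by
    simpa only [zero_mul] using ENNReal.Tendsto.mul_const
      (ENNReal.tendsto_pow_atTop_nhds_zero_of_lt_one hM.β_mul_ret_lt_one)
      (.inr hc.margVal_zero_ne_top)
  have hmarg_pos : 0 < M.marg (c a) := zero_le.trans_lt (hM.utility.marg_strictAnti (lt_add_one _))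
  obtain ⟨n, hn⟩ := (hlim.eventually_lt_const hmarg_pos).exists
  refine ⟨n + 1, lt_of_le_of_ne prob_le_one fun hone => hn.not_ge ?_⟩
  exact hc.marg_le_pow_mul_of_ae_mem_staySet hM.utility n a ((mem_ae_iff_prob_eq_one
    (measurableSet_staySet hc.measurable_nextAsset hc.measurableSet_savings_pos _ a)).2 hone)

lemma ae_exists_savings_eq_zero (hM : M.StabilityAssumptions) (hc : M.EulerPolicy c) (a : ℝ≥0) :
    ∀ᵐ w ∂M.seqLaw, ∃ t, iterPath (M.nextAsset c) a w t ∉ {a | 0 < a - c a} := by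
  obtain ⟨ρ, hρ, hdrift⟩ := hc.exists_lintegral_nextAsset_le
  refine ae_exists_iterPath_notMem hc.measurable_nextAsset hc.measurableSet_savings_pos
    measurable_coe_nnreal_ennreal (ENNReal.add_ne_top.2 ⟨ENNReal.coe_ne_top,
      ENNReal.div_ne_top hM.inc_finite.ne (tsub_pos_of_lt hρ).ne'⟩)
    (fun n => lintegral_iterPath_le hc.measurable_nextAsset measurable_coe_nnreal_ennreal hdrift
      hρ.le n a) fun r => ?_
  obtain ⟨T, hT⟩ := hc.exists_measure_staySet_lt_one hM r
  refine ⟨T, _, hT, fun b hb => measure_mono fun w hw t ht => ?_⟩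
  exact (hw t ht).trans_le <| hc.savings_mono <|
    iterPath_mono hc.monotone_nextAsset (ENNReal.coe_le_coe.1 hb) w t

theorem coalescing (hM : M.StabilityAssumptions) (hc : M.EulerPolicy c) :
    Coalescing (M.nextAsset c) M.shockLaw := by
  refine coalescing_of_ae_exists_notMem (G := {a | 0 < a - c a}) hc.monotone_nextAsset
    (fun a b hab (ha : 0 < a - c a) => ha.trans_le (hc.savings_mono hab)) (fun a ha b hb => ?_)
    (hc.ae_exists_savings_eq_zero hM)
  have hzero {e : ℝ≥0} (he : e ∉ {a | 0 < a - c a}) : e - c e = 0 :=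
    nonpos_iff_eq_zero.1 (not_lt.1 he)
  ext x
  simp only [nextAsset, hzero ha, hzero hb]

theorem exists_stationary (hM : M.StabilityAssumptions) (hc : M.EulerPolicy c) :
    ∃ ψ : Measure ℝ≥0, IsProbabilityMeasure ψ ∧
      (ψ.prod M.shockLaw).map (fun p => M.nextAsset c p.1 p.2) = ψ := by
  obtain ⟨ρ, hρ, hdrift⟩ := hc.exists_lintegral_nextAsset_le
  exact exists_stationary_of_monotone_of_drift hc.measurable_nextAsset hc.monotone_nextAsset
    hc.continuous_nextAsset hdrift hρ hM.inc_finite.ne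

end EulerPolicy

lemma invariant_assetKernel_iff (hc : Measurable c) (φ : Measure ℝ≥0) [SFinite φ] :
    (M.assetKernel hc).Invariant φ ↔
      (φ.prod M.shockLaw).map (fun p => M.nextAsset c p.1 p.2) = φ := by
  have hnext := M.measurable_nextAsset hc
  suffices φ.bind (M.assetKernel hc) = (φ.prod M.shockLaw).map fun p => M.nextAsset c p.1 p.2 by
    rw [Kernel.Invariant, this]
  ext B hB
  rw [Measure.bind_apply hB (Kernel.aemeasurable _), Measure.map_apply hnext hB,
    Measure.prod_apply (hnext hB)]
  exact lintegral_congr fun a => Measure.map_apply (hnext.comp measurable_prodMk_left) hB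

namespace IsWealthPath

variable {μ₀ : Measure ℝ≥0} {Ω : Type*} [MeasurableSpace Ω] {P : Measure Ω}
  {x : ℕ → Ω → Z × E × F} {a : ℕ → Ω → ℝ≥0}

lemma eq_iterPath (ha : M.IsWealthPath c μ₀ P x a) (t : ℕ) (ω : Ω) :
    a t ω = iterPath (M.nextAsset c) (a 0 ω) (fun t => x t ω) t := by
  induction t with
  | zero => rfl
  | succ t ih => rw [ha.step, ih, iterPath]

variable [IsProbabilityMeasure P]

lemma measurePreserving (ha : M.IsWealthPath c μ₀ P x a) :
    MeasurePreserving (fun ω => (a 0 ω, fun t => x t ω)) P (μ₀.prod M.seqLaw) := by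
  have hx : Measurable fun ω t => x t ω := measurable_pi_lambda _ ha.measurable_shock
  refine ⟨ha.measurable_init.prodMk hx, ?_⟩
  rw [(indepFun_iff_map_prod_eq_prod_map_map ha.measurable_init.aemeasurable hx.aemeasurable).1
    ha.indep_init, ha.law_init, ha.indep_shock.map_fun_eq_infinitePi_map ha.measurable_shock]
  simp only [ha.law_shock, seqLaw]

variable [IsProbabilityMeasure μ₀] {ψ : Measure ℝ≥0} [IsProbabilityMeasure ψ]

theorem ae_tendsto_timeAverage (ha : M.IsWealthPath c μ₀ P x a) (hc : Measurable c)
    (hcoal : Coalescing (M.nextAsset c) M.shockLaw)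
    (hψ : (ψ.prod M.shockLaw).map (fun p => M.nextAsset c p.1 p.2) = ψ) {h : ℝ≥0 → ℝ}
    (hint : Integrable h ψ) :
    ∀ᵐ ω ∂P, Tendsto (timeAverage fun t => h (a t ω)) atTop (𝓝 (∫ y, h y ∂ψ)) := by
  filter_upwards [hcoal.ae_tendsto_timeAverage_of_map_eq_prod (M.measurable_nextAsset hc) hψ
    ha.measurePreserving hint] with ω hω
  simpa only [← ha.eq_iterPath] using hω

theorem ae_forall_tendsto_timeAverage (ha : M.IsWealthPath c μ₀ P x a) (hc : Measurable c)
    (hcoal : Coalescing (M.nextAsset c) M.shockLaw)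
    (hψ : (ψ.prod M.shockLaw).map (fun p => M.nextAsset c p.1 p.2) = ψ) :
    ∀ᵐ ω ∂P, ∀ h : ℝ≥0 →ᵇ ℝ,
      Tendsto (timeAverage fun t => h (a t ω)) atTop (𝓝 (∫ y, h y ∂ψ)) := by
  refine ae_forall_boundedContinuous_tendsto_timeAverage fun U hU => ?_
  have hint : Integrable (U.indicator (1 : ℝ≥0 → ℝ)) ψ := (integrable_const 1).indicator hU
  simpa only [integral_indicator_one hU] using ha.ae_tendsto_timeAverage hc hcoal hψ hint

end IsWealthPath

end IncomeFluctuation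

lemma integrable_of_mem_increasingSpan {ψ : Measure ℝ≥0} {h : ℝ≥0 → ℝ}
    (hh : h ∈ increasingSpan ψ) : Integrable h ψ := by
  induction hh using Submodule.span_induction with
  | mem h hh => exact hh.2
  | zero => exact integrable_zero _ _ _
  | add g h _ _ hg hh => exact hg.add hh
  | smul k h _ hh => exact hh.smul k

theorem theoremt_general {m : ℕ} {Z : Set (EuclideanSpace ℝ (Fin m))}
    {E F : Type*} [MeasurableSpace E] [MeasurableSpace F]
    {M : IncomeFluctuation Z E F} (hM : M.StabilityAssumptions) :
    ∃ (c : ℝ≥0 → ℝ≥0) (hc : Measurable c),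
      (M.Candidate (fun s => c s.1) ∧ M.IsOptimal (fun s => c s.1) ∧
        ∀ d : ℝ≥0 × Z → ℝ≥0, M.IsOptimal d → d = fun s => c s.1) ∧
      ∃ ψ : Measure ℝ≥0,
        (IsProbabilityMeasure ψ ∧ (M.assetKernel hc).Invariant ψ ∧
          ∀ φ : Measure ℝ≥0, IsProbabilityMeasure φ → (M.assetKernel hc).Invariant φ → φ = ψ) ∧
        ∀ (μ₀ : Measure ℝ≥0) [IsProbabilityMeasure μ₀] (Ω : Type*) [MeasurableSpace Ω]
          (P : Measure Ω) [IsProbabilityMeasure P] (x : ℕ → Ω → Z × E × F) (a : ℕ → Ω → ℝ≥0),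
          M.IsWealthPath c μ₀ P x a →
          (∀ h, Integrable h ψ → ∀ᵐ ω ∂P,
            Tendsto (timeAverage fun t => h (a t ω)) atTop (𝓝 (∫ y, h y ∂ψ))) ∧
          (∀ᵐ ω ∂P, ∀ h : ℝ≥0 →ᵇ ℝ,
            Tendsto (timeAverage fun t => h (a t ω)) atTop (𝓝 (∫ y, h y ∂ψ))) := by
  obtain ⟨c, hc⟩ := hM.exists_eulerPolicy
  have hcm : Measurable c := hc.continuous.measurable
  have hcoal : Coalescing (M.nextAsset c) M.shockLaw := hc.coalescing hM
  obtain ⟨ψ, hψ_prob, hψ⟩ := hc.exists_stationary hM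
  have hunique (φ : Measure ℝ≥0) (_ : IsProbabilityMeasure φ)
      (hφ : (M.assetKernel hcm).Invariant φ) : φ = ψ :=
    hcoal.stationary_unique hc.measurable_nextAsset hψ
      ((IncomeFluctuation.invariant_assetKernel_iff hcm φ).1 hφ)
  exact ⟨c, hcm,
    ⟨hc.candidate hM.utility, hc.isOptimal hM, fun d hd => hc.eq_of_isOptimal hM hd⟩,
    ψ, ⟨hψ_prob, (IncomeFluctuation.invariant_assetKernel_iff hcm ψ).2 hψ, hunique⟩,
    fun μ₀ _ Ω _ P _ x a ha => ⟨fun h hint => ha.ae_tendsto_timeAverage hcm hcoal hψ hint,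
      ha.ae_forall_tendsto_timeAverage hcm hcoal hψ⟩⟩

theorem theoremt {m : ℕ} (Z : Set (EuclideanSpace ℝ (Fin m))) (hZ : MeasurableSet Z)
    {E F : Type*} [MeasurableSpace E] [MeasurableSpace F]
    (M : IncomeFluctuation Z E F) (hM : M.Assumptions) :
    -- the optimal policy, a function of wealth only, unique in the candidate class
    ∃ (c : ℝ≥0 → ℝ≥0) (hc : Measurable c),
      (M.Candidate (fun s => c s.1) ∧ M.IsOptimal (fun s => c s.1) ∧
        ∀ d : ℝ≥0 × Z → ℝ≥0, M.Candidate d → M.IsOptimal d → d = fun s => c s.1) ∧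
      -- the unique stationary distribution
      ∃ ψ : Measure ℝ≥0,
        (IsProbabilityMeasure ψ ∧ (M.assetKernel hc).Invariant ψ ∧
          ∀ φ : Measure ℝ≥0, IsProbabilityMeasure φ → (M.assetKernel hc).Invariant φ → φ = ψ) ∧
        -- the law of large numbers, for every version of the wealth process
        ∀ (μ₀ : Measure ℝ≥0) [IsProbabilityMeasure μ₀] (Ω : Type*) [MeasurableSpace Ω]
          (P : Measure Ω) [IsProbabilityMeasure P] (x : ℕ → Ω → Z × E × F) (a : ℕ → Ω → ℝ≥0),
          M.IsWealthPath c μ₀ P x a →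
          (∀ h ∈ increasingSpan ψ, ∀ᵐ ω ∂P,
            Tendsto (fun T : ℕ => (1 / (T : ℝ)) * ∑ t ∈ Finset.Icc 1 T, h (a t ω)) atTop
              (𝓝 (∫ y, h y ∂ψ))) ∧
          (∀ᵐ ω ∂P, ∀ h : ℝ≥0 →ᵇ ℝ,
            Tendsto (fun T : ℕ => (1 / (T : ℝ)) * ∑ t ∈ Finset.Icc 1 T, h (a t ω)) atTop
              (𝓝 (∫ y, h y ∂ψ))) := by
  obtain ⟨c, hc, ⟨hcand, hopt, huniq⟩, ψ, hψ, hlln⟩ := theoremt_general hM.stability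
  exact ⟨c, hc, ⟨hcand, hopt, fun d _ hd => huniq d hd⟩, ψ, hψ, fun μ₀ _ Ω _ P _ x a ha =>
    ⟨fun h hh => (hlln μ₀ Ω P x a ha).1 h (integrable_of_mem_increasingSpan hh),
      (hlln μ₀ Ω P x a ha).2⟩⟩
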